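/- Let $0<\alpha<1$, and let $$\phi_\alpha(s)=\Bigl(1-\sum_{n\ge1}\frac{\alpha}{n-\alpha}\,\frac{(is)^n}{n!}\Bigr)^{-1},\qquad s\in\mathbb R .$$ The Darling--Mandelbrot law of parameter $\alpha$, that is, the probability law on $\mathbb R_+$ with characteristic function $\phi_\alpha$, has a unique density $g$ that is continuous on $(0,\infty)$ and zero on $(-\infty,0]$. Put $C_0=\sin(\alpha\pi)/\pi$ and $(f*f)(x)=\int_{\mathbb R} f(y)f(x-y)\,dy$; for $f=g$ this integral converges for every $x\in\mathbb R$. Consider the functions $f:\mathbb R\to\mathbb R$ that are zero on $(-\infty,0]$, continuous on $(0,\infty)$, and differentiable at every non-integer $x>0$ with $$x f'(x)+(1-\alpha)f(x)=-\alpha\,(f*f)(x-1)\qquad(x>0,\ x\notin\mathbb N).$$ Then $g$ is such a function and $g(x)=C_0x^{\alpha-1}+O(1)$ as $x\to0^+$; in particular $g(x)\sim C_0x^{\alpha-1}$. Conversely, $g$ is the only such function $f$ with $f(x)\sim C_0x^{\alpha-1}$ as $x\to0^+$ (hence the only one with $f(x)=C_0x^{\alpha-1}+O(1)$). Moreover,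 $x\mapsto x^{1-\alpha}g(x)$ is nonincreasing on $(0,\infty)$. -/

import Mathlib

open MeasureTheory Set Filter Topology Asymptotics
open scoped Convolution

noncomputable section

namespace DarlingMandelbrot

/-- The function `φ_α(s) = (1 - ∑_{n ≥ 1} α / (n - α) * (i s)^n / n!)⁻¹`
(the sum is indexed by `n + 1`, `n : ℕ`). -/
def phi (α s : ℝ) : ℂ :=
  (1 - ∑' n : ℕ, ((α / ((n : ℝ) + 1 - α) : ℝ) : ℂ) *
    ((Complex.I * (s : ℂ)) ^ (n + 1) / (Nat.factorial (n + 1) : ℂ)))⁻¹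

/-- The Darling–Mandelbrot law of parameter `α`: the probability measure with characteristic
function `φ_α`. -/
structure IsLaw (α : ℝ) (μ : Measure ℝ) : Prop where
  isProbabilityMeasure : IsProbabilityMeasure μ
  charFun_eq : ∀ s : ℝ, charFun μ s = phi α s

/-- `g` is the continuous density on `(0, ∞)` of the Darling–Mandelbrot law of parameter `α`,
extended by `0` to `(-∞, 0]`. -/
structure IsDensity (α : ℝ) (g : ℝ → ℝ) : Prop where
  nonneg : ∀ x, 0 ≤ g x
  eq_zero : ∀ x ≤ 0, g x = 0
  continuousOn : ContinuousOn g (Ioi 0)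
  isLaw : IsLaw α (volume.withDensity fun x => ENNReal.ofReal (g x))

/-- The convolution product `(f * h)(x) = ∫ f(y) h(x - y) dy` on the real line. -/
def conv (f h : ℝ → ℝ) : ℝ → ℝ :=
  f ⋆[ContinuousLinearMap.mul ℝ ℝ, volume] h

/-- `f`, supported on the positive half-line and continuous there, satisfies
`x f'(x) + (1 - α) f(x) = -α (f * f)(x - 1)` at every non-integer `x > 0`. -/
structure IsContinuousSolution (α : ℝ) (f : ℝ → ℝ) : Prop where
  eq_zero : ∀ x ≤ 0, f x = 0
  continuousOn : ContinuousOn f (Ioi 0)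
  equation : ∀ x : ℝ, 0 < x → (∀ n : ℕ, x ≠ n) →
    DifferentiableAt ℝ f x ∧
      x * deriv f x + (1 - α) * f x = -α * conv f f (x - 1)

/-- The constant `C₀ = sin(α π) / π`. -/
def C₀ (α : ℝ) : ℝ := Real.sin (α * Real.pi) / Real.pi

end DarlingMandelbrot

end

/-!
The law `μ` is geometrically infinitely divisible: `φ_α = (1 - ψ)⁻¹`, where `ψ` is the Lévy
exponent of the measure `ν = α x^(-α-1) dx` on `(0, 1]`. Dividing characteristic functions by `is`
or differentiating them gives, respectively,

* `T(ν + ρ) ∗ μ = T(ρ ∗ μ)` for every probability measure `ρ` on the half-line, where `T` is the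
  integrated tail `T(κ) = κ(x, ∞) dx`;
* the size-bias identity `x μ = (x ν) ∗ μ ∗ μ`.

Since `x ν = α T(ν + δ₁)`, together they say that `μ` has a density `g` with
`x g(x) = α (μ(-∞, x] - (μ ∗ μ)(-∞, x - 1])`. The right-hand side is continuous, and the equation
for `g` follows by differentiation. The factor `x^(1 - α)` turns that equation into
`(x^(1 - α) f)' = -α x^(-α) (f * f)(x - 1)`. Hence `x^(1 - α) g` is nonincreasing, a solution is
`f(1) x^(α - 1)` on `(0, 1]`, and it is determined by `f(1)` one unit interval after another.
Finally `T(ν + δ₁) = x^(-α) dx` on `(0, 1]`, so the first identity with `ρ = δ₁` makes the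
convolution of `x^(-α)` with `g` equal to `1` on `(0, 1)`, and the Beta integral
`B(α, 1 - α) = π / sin(α π)` yields `g(1) = C₀`.
-/

noncomputable section

namespace DarlingMandelbrot

section Convolution

variable {M : Type*} [AddMonoid M] [MeasurableSpace M]

lemma conv_univ [MeasurableAdd₂ M] (μ ν : Measure M) [SFinite ν] :
    (μ ∗ ν) univ = μ univ * ν univ := by
  rw [Measure.conv, Measure.map_apply measurable_add .univ, preimage_univ,
    ← univ_prod_univ, Measure.prod_prod]

lemma ae_mem_conv [MeasurableAdd₂ M] {μ ν : Measure M} {S : AddSubmonoid M}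
    (hS : MeasurableSet (S : Set M)) (hμ : ∀ᵐ x ∂μ, x ∈ S) (hν : ∀ᵐ x ∂ν, x ∈ S) :
    ∀ᵐ x ∂(μ ∗ ν), x ∈ S := by
  refine (ae_map_iff (by fun_prop) hS).2 ?_
  filter_upwards [Measure.quasiMeasurePreserving_fst.ae hμ,
    Measure.quasiMeasurePreserving_snd.ae hν] with p h₁ h₂
  exact S.add_mem h₁ h₂

lemma lintegral_enorm_conv_le {E : Type*} [NormedAddCommGroup E] [MeasurableSpace E]
    [BorelSpace E] [SecondCountableTopology E] (μ ν : Measure E) [SFinite ν] :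
    ∫⁻ x, ‖x‖ₑ ∂(μ ∗ ν) ≤ (∫⁻ x, ‖x‖ₑ ∂μ) * ν univ + μ univ * ∫⁻ x, ‖x‖ₑ ∂ν :=
  calc ∫⁻ x, ‖x‖ₑ ∂(μ ∗ ν) = ∫⁻ x, ∫⁻ y, ‖x + y‖ₑ ∂ν ∂μ :=
        Measure.lintegral_conv measurable_enorm
    _ ≤ ∫⁻ x, ∫⁻ y, (‖x‖ₑ + ‖y‖ₑ) ∂ν ∂μ := by gcongr; exact enorm_add_le _ _
    _ = _ := by
      simp_rw [lintegral_add_left measurable_const, lintegral_const]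
      rw [lintegral_add_right _ measurable_const, lintegral_const,
        lintegral_mul_const _ measurable_enorm, mul_comm (μ univ)]

lemma integrable_id_conv {E : Type*} [NormedAddCommGroup E] [MeasurableSpace E] [BorelSpace E]
    [SecondCountableTopology E] {μ ν : Measure E} [IsFiniteMeasure μ] [IsFiniteMeasure ν]
    (hμ : Integrable id μ) (hν : Integrable id ν) : Integrable id (μ ∗ ν) :=
  ⟨by fun_prop, (lintegral_enorm_conv_le μ ν).trans_lt <| ENNReal.add_lt_top.2
    ⟨ENNReal.mul_lt_top hμ.2 (measure_lt_top ν _), ENNReal.mul_lt_top (measure_lt_top μ _) hν.2⟩⟩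

/-- The `n`-fold convolution power of `ν`. -/
def convPow (ν : Measure M) : ℕ → Measure M
  | 0 => Measure.dirac 0
  | n + 1 => convPow ν n ∗ ν

instance isFiniteMeasure_convPow (ν : Measure M) [IsFiniteMeasure ν] (n : ℕ) :
    IsFiniteMeasure (convPow ν n) := by
  induction n with
  | zero => rw [convPow]; infer_instance
  | succ n ih => rw [convPow]; infer_instance

lemma convPow_univ [MeasurableAdd₂ M] (ν : Measure M) [IsFiniteMeasure ν] (n : ℕ) :
    convPow ν n univ = ν univ ^ n := by
  induction n with
  | zero => simp [convPow]
  | succ n ih => rw [convPow, conv_univ, ih, pow_succ]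

lemma ae_mem_convPow [MeasurableAdd₂ M] {ν : Measure M} {S : AddSubmonoid M}
    (hS : MeasurableSet (S : Set M)) (hν : ∀ᵐ x ∂ν, x ∈ S) (n : ℕ) :
    ∀ᵐ x ∂convPow ν n, x ∈ S := by
  induction n with
  | zero => exact (ae_dirac_iff hS).2 S.zero_mem
  | succ n ih => exact ae_mem_conv hS ih hν

lemma charFun_convPow {E : Type*} [NormedAddCommGroup E] [InnerProductSpace ℝ E]
    [MeasurableSpace E] [BorelSpace E] [SecondCountableTopology E] (ν : Measure E)
    [IsFiniteMeasure ν] (n : ℕ) (t : E) : charFun (convPow ν n) t = charFun ν t ^ n := by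
  induction n with
  | zero => simp [convPow, charFun_dirac]
  | succ n ih => rw [convPow, charFun_conv, ih, pow_succ]

end Convolution

section LevyExponent

variable {E : Type*} [NormedAddCommGroup E] [InnerProductSpace ℝ E]

lemma norm_exp_inner_mul_I_sub_one_le (x t : E) :
    ‖Complex.exp (inner ℝ x t * Complex.I) - 1‖ ≤ ‖t‖ * ‖x‖ := by
  rw [mul_comm _ Complex.I, mul_comm ‖t‖]
  exact Real.norm_exp_I_mul_ofReal_sub_one_le.trans (norm_inner_le_norm x t)

variable [MeasurableSpace E]

/-- The characteristic exponent of a Lévy process without drift or Gaussian part whose jumps are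
described by the Lévy measure `ν`. -/
def levyExponent (ν : Measure E) (t : E) : ℂ :=
  ∫ x, (Complex.exp (inner ℝ x t * Complex.I) - 1) ∂ν

lemma levyExponent_real (ν : Measure ℝ) (s : ℝ) :
    levyExponent ν s = ∫ x, (Complex.exp (s * x * Complex.I) - 1) ∂ν := by
  simp [levyExponent]

lemma re_levyExponent_nonpos (ν : Measure E) (t : E) : (levyExponent ν t).re ≤ 0 := by
  by_cases h : Integrable (fun x => Complex.exp (inner ℝ x t * Complex.I) - 1) ν
  · rw [levyExponent, ← RCLike.re_to_complex, ← integral_re h]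
    refine integral_nonpos fun x => ?_
    simpa [Complex.exp_ofReal_mul_I_re] using Real.cos_le_one (inner ℝ x t)
  · simp [levyExponent, integral_undef h]

lemma one_sub_levyExponent_ne_zero (ν : Measure E) (t : E) : 1 - levyExponent ν t ≠ 0 :=
  fun h => by
    have := congrArg Complex.re h
    have := re_levyExponent_nonpos ν t
    simp only [Complex.sub_re, Complex.one_re, Complex.zero_re] at *
    linarith

lemma integrable_exp_inner_mul_I [OpensMeasurableSpace E] (μ : Measure E) [IsFiniteMeasure μ]
    (t : E) : Integrable (fun x => Complex.exp (inner ℝ x t * Complex.I)) μ :=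
  (BoundedContinuousFunction.innerProbChar t).integrable μ

lemma integrable_exp_inner_mul_I_sub_one [OpensMeasurableSpace E] {ν : Measure E}
    (hν : Integrable id ν) (t : E) :
    Integrable (fun x => Complex.exp (inner ℝ x t * Complex.I) - 1) ν :=
  (hν.norm.const_mul ‖t‖).mono' (by fun_prop)
    (ae_of_all _ fun x => norm_exp_inner_mul_I_sub_one_le x t)

lemma tendsto_levyExponent_zero {ν : Measure E} (hν : Integrable id ν) :
    Tendsto (levyExponent ν) (𝓝 0) (𝓝 0) := by
  have hbound (t : E) : ‖levyExponent ν t‖ ≤ ‖t‖ * ∫ x, ‖x‖ ∂ν := by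
    rw [← integral_const_mul]
    exact norm_integral_le_of_norm_le (hν.norm.const_mul _)
      (ae_of_all _ fun x => norm_exp_inner_mul_I_sub_one_le x t)
  refine squeeze_zero_norm hbound ?_
  simpa using (tendsto_norm_zero (E := E)).mul_const (∫ x, ‖x‖ ∂ν)

lemma levyExponent_add_measure [OpensMeasurableSpace E] {ν₁ ν₂ : Measure E}
    (h₁ : Integrable id ν₁) (h₂ : Integrable id ν₂) (t : E) :
    levyExponent (ν₁ + ν₂) t = levyExponent ν₁ t + levyExponent ν₂ t :=
  integral_add_measure (integrable_exp_inner_mul_I_sub_one h₁ t)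
    (integrable_exp_inner_mul_I_sub_one h₂ t)

lemma levyExponent_of_isFiniteMeasure [OpensMeasurableSpace E] (ν : Measure E)
    [IsFiniteMeasure ν] (t : E) : levyExponent ν t = charFun ν t - ν.real univ := by
  rw [levyExponent, integral_sub (integrable_exp_inner_mul_I ν t) (integrable_const _),
    ← charFun_apply]
  simp

end LevyExponent

section CompoundGeometric

/-- The compound geometric law of the finite measure `ν` of mass `m`: the law of a sum of `N`
independent variables of law `m⁻¹ ν`, where `N = n` with probability `mⁿ / (1 + m)ⁿ⁺¹`. -/
def compoundGeometric {M : Type*} [AddMonoid M] [MeasurableSpace M] (ν : Measure M) : Measure M :=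
  Measure.sum fun n => (1 + ν univ)⁻¹ ^ (n + 1) • convPow ν n

lemma inv_one_add_add_inv_one_add_mul {m : ENNReal} (hm : m ≠ ⊤) :
    (1 + m)⁻¹ + (1 + m)⁻¹ * m = 1 := by
  rw [← mul_one_add, ENNReal.inv_mul_cancel (by simp) (by finiteness)]

lemma tsum_inv_one_add_pow_succ_mul_pow {m : ENNReal} (hm : m ≠ ⊤) :
    ∑' n : ℕ, (1 + m)⁻¹ ^ (n + 1) * m ^ n = 1 := by
  have hsum := inv_one_add_add_inv_one_add_mul hm
  set r := (1 + m)⁻¹ with hr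
  have hr_top : r ≠ ⊤ := by simp [hr]
  have hr0 : r ≠ 0 := by simp [hr, hm]
  have hterm (n : ℕ) : r ^ (n + 1) * m ^ n = r * (r * m) ^ n := by ring
  rw [tsum_congr hterm, ENNReal.tsum_mul_left, ENNReal.tsum_geometric,
    ENNReal.sub_eq_of_eq_add (by finiteness) hsum.symm, ENNReal.mul_inv_cancel hr0 hr_top]

section

variable {M : Type*} [AddMonoid M] [MeasurableSpace M] [MeasurableAdd₂ M] {ν : Measure M}

instance isProbabilityMeasure_compoundGeometric [IsFiniteMeasure ν] :
    IsProbabilityMeasure (compoundGeometric ν) where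
  measure_univ := by
    simpa [compoundGeometric, convPow_univ] using
      tsum_inv_one_add_pow_succ_mul_pow (measure_ne_top ν univ)

lemma ae_mem_compoundGeometric {S : AddSubmonoid M} (hS : MeasurableSet (S : Set M))
    (hν : ∀ᵐ x ∂ν, x ∈ S) : ∀ᵐ x ∂compoundGeometric ν, x ∈ S :=
  (Measure.ae_sum_iff' hS).2 fun n => Measure.ae_smul_measure (ae_mem_convPow hS hν n) _

end

variable {E : Type*} [NormedAddCommGroup E] [MeasurableSpace E] [BorelSpace E]
  [SecondCountableTopology E]

lemma charFun_compoundGeometric [InnerProductSpace ℝ E] (ν : Measure E) [IsFiniteMeasure ν]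
    (t : E) : charFun (compoundGeometric ν) t = (1 - levyExponent ν t)⁻¹ := by
  set r : ℂ := (1 + ν.real univ : ℂ)⁻¹ with hr
  have hm : 0 < 1 + ν.real univ := by positivity
  have hm' : (1 + ν.real univ : ℂ) ≠ 0 := mod_cast hm.ne'
  have hterm (n : ℕ) : ∫ x, Complex.exp (inner ℝ x t * Complex.I)
      ∂((1 + ν univ)⁻¹ ^ (n + 1) • convPow ν n) = r * (r * charFun ν t) ^ n := by
    rw [integral_smul_measure, ← charFun_apply, charFun_convPow, ENNReal.toReal_pow,
      ENNReal.toReal_inv, ENNReal.toReal_add ENNReal.one_ne_top (measure_ne_top ν univ),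
      Complex.real_smul, ENNReal.toReal_one, ← Measure.real]
    push_cast
    ring
  have hlt : ‖r * charFun ν t‖ < 1 := by
    rw [norm_mul, hr, norm_inv, inv_mul_lt_iff₀ (by positivity), mul_one, ← Complex.ofReal_one,
      ← Complex.ofReal_add, Complex.norm_of_nonneg hm.le]
    linarith [norm_charFun_le (μ := ν) t]
  rw [levyExponent_of_isFiniteMeasure, charFun_apply, compoundGeometric, integral_sum_measure
    (integrable_exp_inner_mul_I (compoundGeometric ν) t),
    tsum_congr hterm, tsum_mul_left, tsum_geometric_of_norm_lt_one hlt, hr, ← mul_inv]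
  congr 1
  field_simp
  ring

lemma lintegral_enorm_compoundGeometric_le (ν : Measure E) [IsFiniteMeasure ν] :
    ∫⁻ x, ‖x‖ₑ ∂compoundGeometric ν ≤ ∫⁻ x, ‖x‖ₑ ∂ν := by
  have hsum := inv_one_add_add_inv_one_add_mul (measure_ne_top ν univ)
  have hweight := tsum_inv_one_add_pow_succ_mul_pow (measure_ne_top ν univ)
  set m := ν univ
  set r := (1 + m)⁻¹
  set A := ∫⁻ x, ‖x‖ₑ ∂ν
  set a : ℕ → ENNReal := fun n => ∫⁻ x, ‖x‖ₑ ∂convPow ν n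
  have ha_zero : a 0 = 0 := by simp [a, convPow, lintegral_dirac' _ measurable_enorm]
  have ha_succ (n : ℕ) : a (n + 1) ≤ a n * m + m ^ n * A :=
    convPow_univ ν n ▸ lintegral_enorm_conv_le (convPow ν n) ν
  have hpartial (N : ℕ) : ∑ n ∈ Finset.range N, r ^ (n + 1) * a n ≤ A := by
    induction N with
    | zero => simp
    | succ N ih =>
      calc ∑ n ∈ Finset.range (N + 1), r ^ (n + 1) * a n
          = ∑ n ∈ Finset.range N, r ^ (n + 2) * a (n + 1) := by
            simp [Finset.sum_range_succ', ha_zero]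
        _ ≤ ∑ n ∈ Finset.range N, r ^ (n + 2) * (a n * m + m ^ n * A) := by
            gcongr; exact ha_succ _
        _ = r * m * ∑ n ∈ Finset.range N, r ^ (n + 1) * a n +
              r * A * ∑ n ∈ Finset.range N, r ^ (n + 1) * m ^ n := by
            simp_rw [Finset.mul_sum, ← Finset.sum_add_distrib]
            exact Finset.sum_congr rfl fun n _ => by ring
        _ ≤ r * m * A + r * A * 1 := by
            gcongr
            exact (ENNReal.sum_le_tsum _).trans_eq hweight
        _ = A := by
            rw [mul_one, ← add_mul, add_comm, hsum, one_mul]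
  rw [compoundGeometric, lintegral_sum_measure]
  simpa only [lintegral_smul_measure, smul_eq_mul] using ENNReal.tsum_le_of_sum_range_le hpartial

end CompoundGeometric

section GeometricInfiniteDivisibility

variable {E : Type*} [NormedAddCommGroup E] [InnerProductSpace ℝ E] [MeasurableSpace E]

lemma exists_probabilityMeasure_of_tendsto_charFun [FiniteDimensional ℝ E] [BorelSpace E]
    {P : ℕ → ProbabilityMeasure E} {φ : E → ℂ} (hφ : ContinuousAt φ 0)
    (hP : ∀ t, Tendsto (fun n => charFun (P n) t) atTop (𝓝 (φ t))) :
    ∃ Q : ProbabilityMeasure E, ∀ t, charFun Q t = φ t := by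
  have htight : IsTightMeasureSet {((p : ProbabilityMeasure E) : Measure E) | p ∈ range P} := by
    convert isTightMeasureSet_of_tendsto_charFun hφ hP using 1
    ext m
    simp
  obtain ⟨U, hU⟩ := Ultrafilter.exists_le (atTop : Filter ℕ)
  obtain ⟨Q, -, hQ : Tendsto P U (𝓝 Q)⟩ :=
    (isCompact_closure_of_isTightMeasureSet htight).ultrafilter_le_nhds (U.map P)
      (tendsto_principal.2 (.of_forall fun n => subset_closure (mem_range_self n)))
  refine ⟨Q, fun t => tendsto_nhds_unique ?_ ((hP t).mono_left hU)⟩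
  rw [ProbabilityMeasure.tendsto_iff_forall_integral_rclike_tendsto ℂ] at hQ
  simpa only [charFun_eq_integral_innerProbChar] using
    hQ (BoundedContinuousFunction.innerProbChar t)

/-- `μ` is the geometrically infinitely divisible law with Lévy measure `ν`: the law at an
independent exponential time of mean one of a Lévy process with Lévy measure `ν`. -/
structure IsGeomInfDivLaw (ν μ : Measure E) : Prop where
  isProbabilityMeasure : IsProbabilityMeasure μ
  charFun_eq : ∀ t, charFun μ t = (1 - levyExponent ν t)⁻¹

variable [BorelSpace E] [SecondCountableTopology E] {ν μ : Measure E} [SigmaFinite ν]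

instance isFiniteMeasure_restrict_spanningSets (ν : Measure E) [SigmaFinite ν] (n : ℕ) :
    IsFiniteMeasure (ν.restrict (spanningSets ν n)) :=
  isFiniteMeasure_restrict.2 (measure_spanningSets_lt_top ν n).ne

/-- The compound geometric laws of the restrictions of `ν` to sets of finite measure exhausting
the space; they converge to the geometrically infinitely divisible law with Lévy measure `ν`. -/
def geomApprox (ν : Measure E) [SigmaFinite ν] (n : ℕ) : ProbabilityMeasure E :=
  ⟨compoundGeometric (ν.restrict (spanningSets ν n)), inferInstance⟩

lemma tendsto_charFun_geomApprox (hν : Integrable id ν) (t : E) :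
    Tendsto (fun n => charFun (geomApprox ν n) t) atTop (𝓝 (1 - levyExponent ν t)⁻¹) := by
  have hlim : Tendsto (fun n => levyExponent (ν.restrict (spanningSets ν n)) t) atTop
      (𝓝 (levyExponent ν t)) := by
    have := tendsto_setIntegral_of_monotone (measurableSet_spanningSets ν) (monotone_spanningSets ν)
      (integrable_exp_inner_mul_I_sub_one hν t).integrableOn
    rwa [iUnion_spanningSets, setIntegral_univ] at this
  simpa only [geomApprox, ProbabilityMeasure.coe_mk, charFun_compoundGeometric] using
    (tendsto_const_nhds.sub hlim).inv₀ (one_sub_levyExponent_ne_zero ν t)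

theorem exists_isGeomInfDivLaw [FiniteDimensional ℝ E] (hν : Integrable id ν) :
    ∃ μ, IsGeomInfDivLaw ν μ := by
  have hcont : ContinuousAt (fun t => (1 - levyExponent ν t)⁻¹) 0 := by
    refine ContinuousAt.inv₀ (continuousAt_const.sub ?_) (one_sub_levyExponent_ne_zero ν 0)
    have hzero : levyExponent ν 0 = 0 := by simp [levyExponent]
    simpa only [ContinuousAt, hzero] using tendsto_levyExponent_zero hν
  obtain ⟨Q, hQ⟩ := exists_probabilityMeasure_of_tendsto_charFun hcont
    (tendsto_charFun_geomApprox hν)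
  exact ⟨Q, inferInstance, hQ⟩

lemma IsGeomInfDivLaw.tendsto_geomApprox [FiniteDimensional ℝ E] (hμ : IsGeomInfDivLaw ν μ)
    (hν : Integrable id ν) :
    Tendsto (geomApprox ν) atTop (𝓝 ⟨μ, hμ.isProbabilityMeasure⟩) :=
  ProbabilityMeasure.tendsto_of_tendsto_charFun fun t => by
    simpa only [ProbabilityMeasure.coe_mk, hμ.charFun_eq] using tendsto_charFun_geomApprox hν t

lemma IsGeomInfDivLaw.measure_le_liminf [FiniteDimensional ℝ E] (hμ : IsGeomInfDivLaw ν μ)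
    (hν : Integrable id ν) {G : Set E} (hG : IsOpen G) :
    μ G ≤ liminf (fun n => (geomApprox ν n : Measure E) G) atTop :=
  ProbabilityMeasure.le_liminf_measure_open_of_tendsto (hμ.tendsto_geomApprox hν) hG

lemma IsGeomInfDivLaw.ae_mem [FiniteDimensional ℝ E] (hμ : IsGeomInfDivLaw ν μ)
    (hν : Integrable id ν) {S : AddSubmonoid E} (hS : IsClosed (S : Set E))
    (hνS : ∀ᵐ x ∂ν, x ∈ S) : ∀ᵐ x ∂μ, x ∈ S := by
  have hzero (n : ℕ) : (geomApprox ν n : Measure E) (S : Set E)ᶜ = 0 :=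
    ae_mem_compoundGeometric hS.measurableSet (ae_restrict_of_ae hνS)
  have hμS : μ (S : Set E)ᶜ = 0 := by
    simpa [hzero] using hμ.measure_le_liminf hν hS.isOpen_compl
  exact hμS

lemma IsGeomInfDivLaw.integrable_id [FiniteDimensional ℝ E] (hμ : IsGeomInfDivLaw ν μ)
    (hν : Integrable id ν) : Integrable id μ := by
  refine ⟨by fun_prop, ?_⟩
  have hbound (n : ℕ) : ∫⁻ x, ‖x‖ₑ ∂(geomApprox ν n : Measure E) ≤ ∫⁻ x, ‖x‖ₑ ∂ν :=
    (lintegral_enorm_compoundGeometric_le _).trans (setLIntegral_le_lintegral _ _)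
  calc ∫⁻ x, ‖x‖ₑ ∂μ
      ≤ liminf (fun n => ∫⁻ x, ‖x‖ₑ ∂(geomApprox ν n : Measure E)) atTop := by
        simpa only [ofReal_norm] using
          lintegral_le_liminf_lintegral_of_forall_isOpen_measure_le_liminf_measure
            continuous_norm (fun x => norm_nonneg x) fun G hG => hμ.measure_le_liminf hν hG
    _ ≤ liminf (fun _ : ℕ => ∫⁻ x, ‖x‖ₑ ∂ν) atTop :=
        liminf_le_liminf (.of_forall hbound)
    _ < ⊤ := by rw [liminf_const]; exact hν.2

end GeometricInfiniteDivisibility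

section IntegratedTail

/-- The integrated tail of a measure `ν` on the half-line: the measure with density
`x ↦ ν (x, ∞)` on `(0, ∞)`. -/
def integratedTail (ν : Measure ℝ) : Measure ℝ :=
  (volume.restrict (Ioi 0)).withDensity fun x => ν (Ioi x)

lemma measurable_measure_Ioi (ν : Measure ℝ) : Measurable fun x => ν (Ioi x) :=
  Antitone.measurable fun _ _ h => measure_mono (Ioi_subset_Ioi h)

lemma measurable_measure_Iic (ν : Measure ℝ) : Measurable fun x => ν (Iic x) :=
  Monotone.measurable fun _ _ h => measure_mono (Iic_subset_Iic.2 h)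

variable {ν : Measure ℝ}

lemma measurableSet_setOf_pos_lt : MeasurableSet {p : ℝ × ℝ | 0 < p.2 ∧ p.2 < p.1} :=
  (measurableSet_lt measurable_const measurable_snd).inter
    (measurableSet_lt measurable_snd measurable_fst)

lemma integratedTail_eq_map [SFinite ν] :
    integratedTail ν =
      ((ν.prod volume).restrict {p | 0 < p.2 ∧ p.2 < p.1}).map Prod.snd := by
  ext s hs
  rw [Measure.map_apply measurable_snd hs, Measure.restrict_apply (measurable_snd hs),
    Measure.prod_apply_symm ((measurable_snd hs).inter measurableSet_setOf_pos_lt),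
    integratedTail, withDensity_apply _ hs, Measure.restrict_restrict hs,
    ← lintegral_indicator (hs.inter measurableSet_Ioi)]
  refine lintegral_congr fun x => ?_
  by_cases hx : x ∈ s ∩ Ioi 0
  · rw [indicator_of_mem hx]
    congr 1
    ext a
    have h0 : 0 < x := hx.2
    simp [hx.1, h0]
  · rw [indicator_of_notMem hx, eq_comm]
    refine measure_mono_null (fun a ha => hx ?_) measure_empty
    exact ⟨ha.1, ha.2.1⟩

lemma prod_setOf_pos_lt_ne_top (hν : Integrable id ν) :
    (ν.prod volume) {p | 0 < p.2 ∧ p.2 < p.1} ≠ ⊤ := by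
  rw [Measure.prod_apply measurableSet_setOf_pos_lt]
  refine ((lintegral_mono fun a => ?_).trans_lt hν.2).ne
  have hslice : Prod.mk a ⁻¹' {p : ℝ × ℝ | 0 < p.2 ∧ p.2 < p.1} = Ioo 0 a := rfl
  rw [hslice, Real.volume_Ioo, sub_zero, Real.enorm_eq_ofReal_abs]
  exact ENNReal.ofReal_le_ofReal (le_abs_self a)

lemma isFiniteMeasure_integratedTail [SFinite ν] (hν : Integrable id ν) :
    IsFiniteMeasure (integratedTail ν) := by
  have := isFiniteMeasure_restrict.2 (prod_setOf_pos_lt_ne_top hν)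
  rw [integratedTail_eq_map]
  infer_instance

lemma mul_integral_Ioo_exp_mul_I (s : ℝ) {a : ℝ} (ha : 0 ≤ a) :
    s * Complex.I * ∫ x in Ioo 0 a, Complex.exp (s * x * Complex.I) =
      Complex.exp (s * a * Complex.I) - 1 := by
  have hderiv (x : ℝ) : HasDerivAt (fun x : ℝ => Complex.exp (s * x * Complex.I))
      (s * Complex.I * Complex.exp (s * x * Complex.I)) x := by
    have := (((Complex.ofRealCLM.hasDerivAt (x := x)).const_mul (s : ℂ)).mul_const Complex.I).cexp
    simpa [mul_comm] using this
  rw [← integral_const_mul, ← integral_Ioc_eq_integral_Ioo,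
    ← intervalIntegral.integral_of_le ha,
    intervalIntegral.integral_eq_sub_of_hasDerivAt (fun x _ => hderiv x)
      (Continuous.intervalIntegrable (by fun_prop) _ _)]
  simp

lemma mul_I_mul_charFun_integratedTail [SFinite ν] (hν : Integrable id ν)
    (hν₀ : ∀ᵐ x ∂ν, 0 ≤ x) (s : ℝ) :
    s * Complex.I * charFun (integratedTail ν) s = levyExponent ν s := by
  have := isFiniteMeasure_restrict.2 (prod_setOf_pos_lt_ne_top hν)
  have hint : Integrable ({p : ℝ × ℝ | 0 < p.2 ∧ p.2 < p.1}.indicator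
      fun p => Complex.exp (s * p.2 * Complex.I)) (ν.prod volume) := by
    rw [integrable_indicator_iff measurableSet_setOf_pos_lt]
    refine (integrable_const (1 : ℝ)).mono' (by fun_prop) (ae_of_all _ fun p => ?_)
    rw [← Complex.ofReal_mul, Complex.norm_exp_ofReal_mul_I]
  rw [charFun_apply_real, integratedTail_eq_map, integral_map measurable_snd.aemeasurable
    (by fun_prop), ← integral_indicator measurableSet_setOf_pos_lt, integral_prod _ hint,
    ← integral_const_mul, levyExponent_real]
  refine integral_congr_ae ?_
  filter_upwards [hν₀] with a ha
  rw [← mul_integral_Ioo_exp_mul_I s ha, ← integral_indicator measurableSet_Ioo]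
  rfl

lemma integratedTail_ext_levyExponent {κ : Measure ℝ} [IsFiniteMeasure κ] [SFinite ν]
    (hν : Integrable id ν) (hν₀ : ∀ᵐ x ∂ν, 0 ≤ x)
    (h : ∀ s, s * Complex.I * charFun κ s = levyExponent ν s) : κ = integratedTail ν := by
  have := isFiniteMeasure_integratedTail hν
  refine Measure.ext_of_charFun (Continuous.ext_on (dense_compl_singleton (0 : ℝ))
    continuous_charFun continuous_charFun fun s hs => ?_)
  refine mul_left_cancel₀ (mul_ne_zero (Complex.ofReal_ne_zero.2 hs) Complex.I_ne_zero) ?_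
  rw [h, mul_I_mul_charFun_integratedTail hν hν₀]

end IntegratedTail

section Renewal

variable {ν μ ρ : Measure ℝ} [SigmaFinite ν]

lemma ae_nonneg_conv (hρ₀ : ∀ᵐ x ∂ρ, 0 ≤ x) (hμ₀ : ∀ᵐ x ∂μ, 0 ≤ x) :
    ∀ᵐ x ∂(ρ ∗ μ), 0 ≤ x :=
  ae_mem_conv (S := AddSubmonoid.nonneg ℝ) measurableSet_Ici hρ₀ hμ₀

lemma IsGeomInfDivLaw.ae_nonneg (hμ : IsGeomInfDivLaw ν μ) (hν : Integrable id ν)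
    (hν₀ : ∀ᵐ x ∂ν, 0 ≤ x) : ∀ᵐ x ∂μ, 0 ≤ x :=
  hμ.ae_mem (S := AddSubmonoid.nonneg ℝ) hν isClosed_Ici hν₀

/- With `ψ` the characteristic exponent of `ν` and `r` the characteristic function of `ρ`, this is
`(ψ + r - 1) / (1 - ψ) = r / (1 - ψ) - 1`. -/
theorem IsGeomInfDivLaw.integratedTail_add_conv (hμ : IsGeomInfDivLaw ν μ)
    (hν : Integrable id ν) (hν₀ : ∀ᵐ x ∂ν, 0 ≤ x) [IsProbabilityMeasure ρ]
    (hρ : Integrable id ρ) (hρ₀ : ∀ᵐ x ∂ρ, 0 ≤ x) :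
    integratedTail (ν + ρ) ∗ μ = integratedTail (ρ ∗ μ) := by
  have := hμ.isProbabilityMeasure
  have hint : Integrable id (ν + ρ) := hν.add_measure hρ
  have hnonneg : ∀ᵐ x ∂(ν + ρ), 0 ≤ x := ae_add_measure_iff.2 ⟨hν₀, hρ₀⟩
  have := isFiniteMeasure_integratedTail hint
  refine integratedTail_ext_levyExponent (integrable_id_conv hρ (hμ.integrable_id hν))
    (ae_nonneg_conv hρ₀ (hμ.ae_nonneg hν hν₀)) fun s => ?_
  have hne := one_sub_levyExponent_ne_zero ν s
  rw [charFun_conv, ← mul_assoc, mul_I_mul_charFun_integratedTail hint hnonneg,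
    levyExponent_add_measure hν hρ, levyExponent_of_isFiniteMeasure ρ,
    levyExponent_of_isFiniteMeasure (ρ ∗ μ), charFun_conv, hμ.charFun_eq, probReal_univ,
    probReal_univ]
  field_simp
  push_cast
  ring

lemma integratedTail_add_dirac_zero (ν : Measure ℝ) :
    integratedTail (ν + Measure.dirac 0) = integratedTail ν :=
  withDensity_congr_ae <| by
    filter_upwards [ae_restrict_mem measurableSet_Ioi] with x hx
    have hx : ¬x < 0 := not_lt.2 (le_of_lt hx)
    simp [hx]

theorem IsGeomInfDivLaw.integratedTail_conv (hμ : IsGeomInfDivLaw ν μ) (hν : Integrable id ν)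
    (hν₀ : ∀ᵐ x ∂ν, 0 ≤ x) : integratedTail ν ∗ μ = integratedTail μ := by
  have := hμ.isProbabilityMeasure
  have h := hμ.integratedTail_add_conv (ρ := Measure.dirac 0) hν hν₀
    (integrable_dirac (by finiteness)) (by simp [ae_dirac_eq])
  rwa [integratedTail_add_dirac_zero, Measure.dirac_zero_conv] at h

lemma isFiniteMeasure_withDensity_id {κ : Measure ℝ} (hκ : Integrable id κ) :
    IsFiniteMeasure (κ.withDensity fun x => ENNReal.ofReal x) :=
  isFiniteMeasure_withDensity_ofReal hκ.2

lemma hasDerivAt_levyExponent {κ : Measure ℝ} (hκ : Integrable id κ) (hκ₀ : ∀ᵐ x ∂κ, 0 ≤ x)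
    (s : ℝ) : HasDerivAt (levyExponent κ)
      (Complex.I * charFun (κ.withDensity fun x => ENNReal.ofReal x) s) s := by
  have hderiv (x s : ℝ) : HasDerivAt (fun s : ℝ => Complex.exp (s * x * Complex.I) - 1)
      (x * Complex.I * Complex.exp (s * x * Complex.I)) s := by
    have := (((Complex.ofRealCLM.hasDerivAt (x := s)).mul_const (x : ℂ)).mul_const
      Complex.I).cexp.sub_const 1
    simpa [mul_comm] using this
  have hint : Integrable (fun x : ℝ => Complex.exp (s * x * Complex.I) - 1) κ := by
    simpa using integrable_exp_inner_mul_I_sub_one hκ s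
  have key := (hasDerivAt_integral_of_dominated_loc_of_deriv_le (μ := κ) (𝕜 := ℝ)
    (F' := fun s x => x * Complex.I * Complex.exp (s * x * Complex.I)) univ_mem
    (.of_forall fun s => by fun_prop) hint (by fun_prop)
    (ae_of_all _ fun x s _ => ?_) hκ.norm (ae_of_all _ fun x s _ => hderiv x s)).2
  · simp_rw [← levyExponent_real] at key
    refine key.congr_deriv ?_
    rw [charFun_apply_real, integral_withDensity_eq_integral_toReal_smul (by fun_prop) (by simp),
      ← integral_const_mul]
    refine integral_congr_ae ?_
    filter_upwards [hκ₀] with x hx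
    rw [ENNReal.toReal_ofReal hx, Complex.real_smul]
    ring
  · rw [norm_mul, ← Complex.ofReal_mul, Complex.norm_exp_ofReal_mul_I]
    simp

/- Differentiate the equality `φ = (1 - ψ)⁻¹` between characteristic functions. -/
theorem IsGeomInfDivLaw.withDensity_id (hμ : IsGeomInfDivLaw ν μ) (hν : Integrable id ν)
    (hν₀ : ∀ᵐ x ∂ν, 0 ≤ x) :
    μ.withDensity (fun x => ENNReal.ofReal x) =
      (ν.withDensity fun x => ENNReal.ofReal x) ∗ μ ∗ μ := by
  have := hμ.isProbabilityMeasure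
  have hint := hμ.integrable_id hν
  have := isFiniteMeasure_withDensity_id hν
  have := isFiniteMeasure_withDensity_id hint
  refine Measure.ext_of_charFun (funext fun s => ?_)
  have hderiv := ((hasDerivAt_levyExponent hν hν₀ s).const_sub 1).fun_inv
    (one_sub_levyExponent_ne_zero ν s)
  have hderiv' := hasDerivAt_levyExponent hint (hμ.ae_nonneg hν hν₀) s
  have heq : levyExponent μ = fun s => (1 - levyExponent ν s)⁻¹ - 1 := by
    funext s
    simp [levyExponent_of_isFiniteMeasure, hμ.charFun_eq]
  rw [heq] at hderiv'
  refine mul_left_cancel₀ Complex.I_ne_zero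
    ((hderiv'.unique (hderiv.sub_const 1)).trans ?_)
  simp only [charFun_conv, hμ.charFun_eq]
  field_simp

end Renewal

section SizeBias

lemma measure_mul_measure_singleton_zero_le_conv {M : Type*} [AddMonoid M] [MeasurableSpace M]
    [MeasurableAdd₂ M] (κ μ : Measure M) [SFinite μ] {S : Set M} (hS : MeasurableSet S) :
    κ S * μ {0} ≤ (κ ∗ μ) S := by
  rw [Measure.conv, Measure.map_apply measurable_add hS, ← Measure.prod_prod]
  refine measure_mono fun p hp => ?_
  simpa [mem_singleton_iff.1 hp.2] using hp.1

lemma integratedTail_le_volume (μ : Measure ℝ) [IsProbabilityMeasure μ] :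
    integratedTail μ ≤ volume :=
  calc integratedTail μ ≤ (volume.restrict (Ioi 0)).withDensity 1 :=
        withDensity_mono (ae_of_all _ fun _ => prob_le_one)
    _ = volume.restrict (Ioi 0) := withDensity_one
    _ ≤ volume := Measure.restrict_le_self

lemma mul_measure_Ioi_le_integratedTail (ν : Measure ℝ) (x : ℝ) :
    ν (Ioi x) * ENNReal.ofReal x ≤ integratedTail ν (Ioo 0 x) := by
  rw [integratedTail, withDensity_apply _ measurableSet_Ioo,
    Measure.restrict_restrict measurableSet_Ioo, inter_eq_left.2 Ioo_subset_Ioi_self]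
  calc ν (Ioi x) * ENNReal.ofReal x = ∫⁻ _ in Ioo 0 x, ν (Ioi x) := by simp
    _ ≤ ∫⁻ y in Ioo 0 x, ν (Ioi y) :=
        setLIntegral_mono (measurable_measure_Ioi ν)
          fun y hy => measure_mono (Ioi_subset_Ioi hy.2.le)

variable {ν μ ρ : Measure ℝ}

theorem IsGeomInfDivLaw.measure_singleton_zero [SigmaFinite ν] (hμ : IsGeomInfDivLaw ν μ)
    (hν : Integrable id ν) (hν₀ : ∀ᵐ x ∂ν, 0 ≤ x) (htop : ν (Ioi 0) = ⊤) : μ {0} = 0 := by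
  have := hμ.isProbabilityMeasure
  have hle {x : ℝ} (hx : 0 < x) : ν (Ioi x) * μ {0} ≤ 1 := by
    have hx' : ENNReal.ofReal x ≠ 0 := by simpa using hx
    refine (ENNReal.mul_le_mul_iff_left hx' ENNReal.ofReal_ne_top).1 ?_
    calc ν (Ioi x) * μ {0} * ENNReal.ofReal x
        = ν (Ioi x) * ENNReal.ofReal x * μ {0} := by ring
      _ ≤ integratedTail ν (Ioo 0 x) * μ {0} := by
          gcongr; exact mul_measure_Ioi_le_integratedTail ν x
      _ ≤ (integratedTail ν ∗ μ) (Ioo 0 x) :=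
          measure_mul_measure_singleton_zero_le_conv _ _ measurableSet_Ioo
      _ ≤ volume (Ioo 0 x) := by
          rw [hμ.integratedTail_conv hν hν₀]
          exact integratedTail_le_volume μ _
      _ = 1 * ENNReal.ofReal x := by simp
  have hanti : Antitone fun n : ℕ => (1 : ℝ) / (n + 1) := fun m n hmn => Nat.one_div_le_one_div hmn
  have hunion : ⋃ n : ℕ, Ioi ((1 : ℝ) / (n + 1)) = Ioi 0 :=
    (isGLB_of_tendsto_atTop hanti tendsto_one_div_add_atTop_nhds_zero_nat).iUnion_Ioi_eq
  have hmono : Monotone fun n : ℕ => Ioi ((1 : ℝ) / (n + 1)) :=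
    fun m n hmn => Ioi_subset_Ioi (hanti hmn)
  have htop_le : ν (Ioi 0) * μ {0} ≤ 1 := by
    rw [← hunion, hmono.measure_iUnion, ENNReal.iSup_mul]
    exact iSup_le fun n => hle (by positivity)
  by_contra hne
  simp [htop, ENNReal.top_mul hne] at htop_le

lemma withDensity_conv {f : ℝ → ENNReal} (hf : Measurable f) (μ : Measure ℝ) [SFinite μ] :
    volume.withDensity f ∗ μ = volume.withDensity fun x => ∫⁻ y, f (x - y) ∂μ := by
  have hm : Measurable fun x : ℝ => ∫⁻ y, f (x - y) ∂μ :=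
    Measurable.lintegral_prod_right' (f := fun p : ℝ × ℝ => f (p.1 - p.2)) (by fun_prop)
  refine Measure.ext_of_lintegral _ fun φ hφ => ?_
  have hm' : Measurable fun x : ℝ => ∫⁻ y, φ (x + y) ∂μ :=
    Measurable.lintegral_prod_right' (f := fun p : ℝ × ℝ => φ (p.1 + p.2)) (by fun_prop)
  rw [Measure.lintegral_conv hφ, lintegral_withDensity_eq_lintegral_mul _ hf hm',
    lintegral_withDensity_eq_lintegral_mul _ hm hφ]
  calc ∫⁻ x, f x * ∫⁻ y, φ (x + y) ∂μ
      = ∫⁻ x, ∫⁻ y, f x * φ (x + y) ∂μ :=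
        lintegral_congr fun x => (lintegral_const_mul _ (by fun_prop)).symm
    _ = ∫⁻ y, ∫⁻ x, f x * φ (x + y) ∂volume ∂μ := lintegral_lintegral_swap
        (f := fun x y => f x * φ (x + y)) (by fun_prop)
    _ = ∫⁻ y, ∫⁻ x, f (x - y) * φ x ∂volume ∂μ := lintegral_congr fun y => by
        simpa using (lintegral_sub_right_eq_self (fun x => f x * φ (x + y)) y).symm
    _ = ∫⁻ x, ∫⁻ y, f (x - y) * φ x ∂μ := lintegral_lintegral_swap
        (f := fun y x => f (x - y) * φ x) (by fun_prop)
    _ = ∫⁻ x, (∫⁻ y, f (x - y) ∂μ) * φ x :=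
        lintegral_congr fun x => lintegral_mul_const _ (by fun_prop)

lemma conv_Iic (ρ μ : Measure ℝ) [SFinite ρ] [SFinite μ] (x : ℝ) :
    (ρ ∗ μ) (Iic x) = ∫⁻ y, ρ (Iic (x - y)) ∂μ := by
  rw [Measure.conv, Measure.map_apply measurable_add measurableSet_Iic,
    Measure.prod_apply_symm (measurable_add measurableSet_Iic)]
  refine lintegral_congr fun y => congrArg ρ ?_
  ext z
  simp [le_sub_iff_add_le]

lemma integratedTail_eq_withDensity (ρ : Measure ℝ) :
    integratedTail ρ = volume.withDensity ((Ici 0).indicator fun x => ρ (Ioi x)) := by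
  rw [withDensity_indicator measurableSet_Ici, ← restrict_Ioi_eq_restrict_Ici, integratedTail]

lemma lintegral_indicator_Ici_add_conv_Iic [IsProbabilityMeasure ρ] [SFinite μ]
    (hρ : ∀ᵐ x ∂ρ, 0 ≤ x) (x : ℝ) :
    ∫⁻ y, (Ici 0).indicator (fun z => ρ (Ioi z)) (x - y) ∂μ + (ρ ∗ μ) (Iic x) = μ (Iic x) := by
  have hm : Measurable fun y : ℝ => ρ (Iic (x - y)) :=
    (measurable_measure_Iic ρ).comp (measurable_const.sub measurable_id)
  rw [conv_Iic, ← lintegral_add_right _ hm, ← lintegral_indicator_one measurableSet_Iic]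
  refine lintegral_congr fun y => ?_
  by_cases hy : y ≤ x
  · rw [indicator_of_mem (show x - y ∈ Ici 0 from sub_nonneg.2 hy),
      indicator_of_mem (show y ∈ Iic x from hy), Pi.one_apply, ← compl_Iic, add_comm,
      prob_add_prob_compl measurableSet_Iic]
  · have hneg : x - y < 0 := sub_neg.2 (not_le.1 hy)
    rw [indicator_of_notMem (show x - y ∉ Ici 0 from not_le.2 hneg),
      indicator_of_notMem (show y ∉ Iic x from hy), zero_add]
    exact measure_mono_null (fun z hz => not_le.2 (lt_of_le_of_lt hz hneg)) hρ

theorem integratedTail_conv_eq_withDensity [IsProbabilityMeasure ρ] [IsFiniteMeasure μ]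
    (hρ : ∀ᵐ x ∂ρ, 0 ≤ x) :
    integratedTail ρ ∗ μ = volume.withDensity fun x => μ (Iic x) - (ρ ∗ μ) (Iic x) := by
  rw [integratedTail_eq_withDensity,
    withDensity_conv ((measurable_measure_Ioi ρ).indicator measurableSet_Ici)]
  congr 1
  funext x
  exact ENNReal.eq_sub_of_add_eq (measure_ne_top _ _) (lintegral_indicator_Ici_add_conv_Iic hρ x)

theorem IsGeomInfDivLaw.withDensity_id_eq [SigmaFinite ν] [IsProbabilityMeasure ρ]
    (hμ : IsGeomInfDivLaw ν μ) (hν : Integrable id ν) (hν₀ : ∀ᵐ x ∂ν, 0 ≤ x)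
    (hρ : Integrable id ρ) (hρ₀ : ∀ᵐ x ∂ρ, 0 ≤ x) {c : ENNReal}
    (hνρ : ν.withDensity (fun x => ENNReal.ofReal x) = c • integratedTail (ν + ρ)) :
    μ.withDensity (fun x => ENNReal.ofReal x) =
      volume.withDensity fun x => c * (μ (Iic x) - (ρ ∗ μ ∗ μ) (Iic x)) := by
  have := hμ.isProbabilityMeasure
  have := isFiniteMeasure_integratedTail (hν.add_measure hρ)
  have hm : Measurable fun x => μ (Iic x) - (ρ ∗ μ ∗ μ) (Iic x) :=
    (measurable_measure_Iic _).sub (measurable_measure_Iic _)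
  rw [hμ.withDensity_id hν hν₀, hνρ, Measure.conv_smul_left, ← Measure.conv_assoc,
    hμ.integratedTail_add_conv hν hν₀ hρ hρ₀,
    integratedTail_conv_eq_withDensity (ae_nonneg_conv hρ₀ (hμ.ae_nonneg hν hν₀)),
    Measure.conv_assoc, ← withDensity_smul _ hm]
  rfl

end SizeBias

section LevyMeasure

variable {α : ℝ}

/-- The Lévy measure `α x^(-α-1) dx` on `(0, 1]`, the jump measure of an `α`-stable subordinator
with the jumps larger than `1` removed. -/
def levyMeasure (α : ℝ) : Measure ℝ :=
  (volume.restrict (Ioc 0 1)).withDensity fun x => ENNReal.ofReal (α * x ^ (-α - 1))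

instance sigmaFinite_levyMeasure (α : ℝ) : SigmaFinite (levyMeasure α) :=
  SigmaFinite.withDensity_ofReal _

lemma ae_mem_Ioc_levyMeasure (α : ℝ) : ∀ᵐ x ∂levyMeasure α, x ∈ Ioc 0 1 :=
  (withDensity_absolutelyContinuous _ _).ae_le (ae_restrict_mem measurableSet_Ioc)

lemma ae_nonneg_levyMeasure (α : ℝ) : ∀ᵐ x ∂levyMeasure α, 0 ≤ x := by
  filter_upwards [ae_mem_Ioc_levyMeasure α] with x hx using hx.1.le

lemma rpow_neg_sub_one_mul_self (α : ℝ) {x : ℝ} (hx : 0 < x) : x ^ (-α - 1) * x = x ^ (-α) := by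
  rw [Real.rpow_sub_one hx.ne', div_mul_cancel₀ _ hx.ne']

lemma integrableOn_rpow_Ioc_zero_one {p : ℝ} (hp : -1 < p) :
    IntegrableOn (fun x : ℝ => x ^ p) (Ioc 0 1) :=
  (intervalIntegrable_iff_integrableOn_Ioc_of_le zero_le_one).1
    (intervalIntegral.intervalIntegrable_rpow' hp)

lemma integral_levyMeasure (hα₀ : 0 < α) {F : Type*} [NormedAddCommGroup F] [NormedSpace ℝ F]
    (f : ℝ → F) :
    ∫ x, f x ∂levyMeasure α = ∫ x in Ioc 0 1, (α * x ^ (-α - 1)) • f x := by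
  rw [levyMeasure, integral_withDensity_eq_integral_toReal_smul (by fun_prop) (by simp)]
  refine setIntegral_congr_fun measurableSet_Ioc fun x hx => ?_
  have hx₀ := hx.1
  rw [ENNReal.toReal_ofReal (by positivity)]

lemma integrable_id_levyMeasure (hα₀ : 0 < α) (hα₁ : α < 1) : Integrable id (levyMeasure α) := by
  refine (integrable_withDensity_iff_integrable_smul' (by fun_prop) (by simp)).2 ?_
  refine ((integrableOn_rpow_Ioc_zero_one (p := -α) (by linarith)).integrable.const_mul α).congr ?_
  filter_upwards [ae_restrict_mem measurableSet_Ioc] with x hx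
  have hx₀ := hx.1
  rw [ENNReal.toReal_ofReal (by positivity), id_eq, smul_eq_mul, mul_assoc,
    rpow_neg_sub_one_mul_self α hx₀]

lemma levyMeasure_Ioi (hα₀ : 0 < α) {x : ℝ} (hx : x ∈ Ioc 0 1) :
    levyMeasure α (Ioi x) = ENNReal.ofReal (x ^ (-α) - 1) := by
  have hzero : (0 : ℝ) ∉ uIcc x 1 := by
    rw [uIcc_of_le hx.2]
    exact fun h => not_le.2 hx.1 h.1
  have hint : IntegrableOn (fun y => α * y ^ (-α - 1)) (Ioc x 1) :=
    (intervalIntegrable_iff_integrableOn_Ioc_of_le hx.2).1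
      ((intervalIntegral.intervalIntegrable_rpow (Or.inr hzero)).const_mul α)
  have hnonneg : 0 ≤ᵐ[volume.restrict (Ioc x 1)] fun y => α * y ^ (-α - 1) := by
    filter_upwards [ae_restrict_mem measurableSet_Ioc] with y hy
    have := hx.1.trans hy.1
    positivity
  have hset : Ioi x ∩ Ioc 0 1 = Ioc x 1 := by
    rw [inter_comm, Ioc_inter_Ioi, sup_of_le_right hx.1.le]
  rw [levyMeasure, withDensity_apply _ measurableSet_Ioi,
    Measure.restrict_restrict measurableSet_Ioi, hset,
    ← ofReal_integral_eq_lintegral_ofReal hint hnonneg, integral_const_mul,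
    ← intervalIntegral.integral_of_le hx.2,
    integral_rpow (Or.inr ⟨by linarith, hzero⟩), Real.one_rpow, sub_add_cancel]
  congr 1
  field_simp
  ring

lemma levyMeasure_Ioi_zero (hα₀ : 0 < α) : levyMeasure α (Ioi 0) = ⊤ := by
  have hlim : Tendsto (fun x : ℝ => ENNReal.ofReal (x ^ (-α) - 1)) (𝓝[>] 0) (𝓝 ⊤) :=
    ENNReal.tendsto_ofReal_atTop.comp <| tendsto_atTop_add_const_right _ _ <|
      tendsto_rpow_neg_nhdsGT_zero (neg_neg_of_pos hα₀)
  refine top_unique (le_of_tendsto hlim ?_)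
  filter_upwards [Ioc_mem_nhdsGT zero_lt_one] with x hx
  rw [← levyMeasure_Ioi hα₀ hx]
  exact measure_mono (Ioi_subset_Ioi hx.1.le)

lemma integratedTail_levyMeasure_add_dirac (hα₀ : 0 < α) :
    integratedTail (levyMeasure α + Measure.dirac 1) =
      (volume.restrict (Ioc 0 1)).withDensity fun x => ENNReal.ofReal (x ^ (-α)) := by
  rw [integratedTail, ← withDensity_indicator measurableSet_Ioi,
    ← withDensity_indicator measurableSet_Ioc]
  refine withDensity_congr_ae ?_
  filter_upwards [Measure.ae_ne volume (1 : ℝ)] with x hx₁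
  rcases le_or_gt x 0 with hx₀ | hx₀
  · rw [indicator_of_notMem (show x ∉ Ioi 0 from not_lt.2 hx₀),
      indicator_of_notMem fun h => not_lt.2 hx₀ h.1]
  rw [indicator_of_mem (mem_Ioi.2 hx₀), Measure.add_apply, Measure.dirac_apply' _ measurableSet_Ioi]
  rcases hx₁.lt_or_gt with hlt | hgt
  · have hone : 0 ≤ x ^ (-α) - 1 :=
      sub_nonneg.2 (Real.one_le_rpow_of_pos_of_le_one_of_nonpos hx₀ hlt.le (by linarith))
    rw [levyMeasure_Ioi hα₀ ⟨hx₀, hlt.le⟩, indicator_of_mem (mem_Ioi.2 hlt),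
      indicator_of_mem (mem_Ioc.2 ⟨hx₀, hlt.le⟩), Pi.one_apply, ← ENNReal.ofReal_one,
      ← ENNReal.ofReal_add hone zero_le_one, sub_add_cancel]
  · have hzero : levyMeasure α (Ioi x) = 0 :=
      measure_mono_null (fun y hy => fun h => not_le.2 (hgt.trans hy) h.2)
        (ae_mem_Ioc_levyMeasure α)
    rw [hzero, indicator_of_notMem (show (1 : ℝ) ∉ Ioi x from not_lt.2 hgt.le),
      indicator_of_notMem fun h => not_le.2 hgt h.2, add_zero]

lemma withDensity_id_levyMeasure (hα₀ : 0 < α) :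
    (levyMeasure α).withDensity (fun x => ENNReal.ofReal x) =
      ENNReal.ofReal α • integratedTail (levyMeasure α + Measure.dirac 1) := by
  rw [integratedTail_levyMeasure_add_dirac hα₀, levyMeasure,
    ← withDensity_mul _ (by fun_prop) (by fun_prop), ← withDensity_smul _ (by fun_prop)]
  refine withDensity_congr_ae ?_
  filter_upwards [ae_restrict_mem measurableSet_Ioc] with x hx
  have hx₀ := hx.1
  rw [Pi.mul_apply, Pi.smul_apply, smul_eq_mul, ← ENNReal.ofReal_mul (by positivity),
    ← ENNReal.ofReal_mul hα₀.le, mul_assoc, rpow_neg_sub_one_mul_self α hx₀]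

end LevyMeasure

section CharacteristicFunction

variable {α : ℝ}

lemma integral_Ioc_rpow_natCast_sub (hα₁ : α < 1) (n : ℕ) :
    ∫ x in Ioc (0 : ℝ) 1, x ^ ((n : ℝ) - α) = 1 / ((n : ℝ) + 1 - α) := by
  have hn : (-1 : ℝ) < n - α := by linarith [n.cast_nonneg (α := ℝ)]
  rw [← intervalIntegral.integral_of_le zero_le_one, integral_rpow (Or.inl hn),
    Real.one_rpow, Real.zero_rpow (by linarith), sub_zero]
  ring_nf

lemma norm_one_div_natCast_sub_le (hα₁ : α < 1) (n : ℕ) :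
    ‖(1 / ((n : ℝ) + 1 - α) : ℝ)‖ ≤ 1 / (1 - α) := by
  have hle : 1 - α ≤ n + 1 - α := by linarith [n.cast_nonneg (α := ℝ)]
  rw [Real.norm_of_nonneg (one_div_nonneg.2 ((sub_pos.2 hα₁).le.trans hle))]
  exact one_div_le_one_div_of_le (sub_pos.2 hα₁) hle

lemma integral_Ioc_tsum_mul_rpow (hα₁ : α < 1) {c : ℕ → ℂ} (hc : Summable fun n => ‖c n‖) :
    ∫ x in Ioc (0 : ℝ) 1, ∑' n, c n * ((x ^ ((n : ℝ) - α) : ℝ) : ℂ) =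
      ∑' n, c n * ((1 / ((n : ℝ) + 1 - α) : ℝ) : ℂ) := by
  have hint (n : ℕ) : Integrable (fun x : ℝ => c n * ((x ^ ((n : ℝ) - α) : ℝ) : ℂ))
      (volume.restrict (Ioc 0 1)) :=
    (integrableOn_rpow_Ioc_zero_one (by linarith [n.cast_nonneg (α := ℝ)])).ofReal.const_mul _
  have hnorm (n : ℕ) : ∫ x in Ioc (0 : ℝ) 1, ‖c n * ((x ^ ((n : ℝ) - α) : ℝ) : ℂ)‖ =
      ‖c n‖ * (1 / ((n : ℝ) + 1 - α)) := by
    rw [← integral_Ioc_rpow_natCast_sub hα₁, ← integral_const_mul]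
    refine setIntegral_congr_fun measurableSet_Ioc fun x hx => ?_
    rw [norm_mul, Complex.norm_real, Real.norm_of_nonneg (Real.rpow_nonneg hx.1.le _)]
  have hsum : Summable fun n => ∫ x in Ioc (0 : ℝ) 1, ‖c n * ((x ^ ((n : ℝ) - α) : ℝ) : ℂ)‖ := by
    refine Summable.of_norm_bounded (hc.mul_right (1 / (1 - α))) fun n => ?_
    rw [hnorm n, norm_mul, norm_norm]
    gcongr
    exact norm_one_div_natCast_sub_le hα₁ n
  rw [← integral_tsum_of_summable_integral_norm hint hsum]
  refine tsum_congr fun n => ?_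
  rw [integral_const_mul, integral_complex_ofReal, integral_Ioc_rpow_natCast_sub hα₁]

lemma exp_sub_one_mul_rpow_eq_tsum (α : ℝ) (z : ℂ) {x : ℝ} (hx : 0 < x) :
    (Complex.exp (z * x) - 1) * ((x ^ (-α - 1) : ℝ) : ℂ) =
      ∑' n : ℕ, z ^ (n + 1) / (Nat.factorial (n + 1) : ℂ) * ((x ^ ((n : ℝ) - α) : ℝ) : ℂ) := by
  have hexp : HasSum (fun n : ℕ => (z * x) ^ n / (Nat.factorial n : ℂ)) (Complex.exp (z * x)) := by
    rw [Complex.exp_eq_exp_ℂ]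
    exact NormedSpace.expSeries_div_hasSum_exp _
  have htail : HasSum (fun n : ℕ => (z * x) ^ (n + 1) / (Nat.factorial (n + 1) : ℂ))
      (Complex.exp (z * x) - 1) := by
    simpa using (hasSum_nat_add_iff' 1).2 hexp
  rw [← (htail.mul_right _).tsum_eq]
  refine tsum_congr fun n => ?_
  rw [show (n : ℝ) - α = ((n + 1 : ℕ) : ℝ) + (-α - 1) by push_cast; ring, Real.rpow_add hx,
    Real.rpow_natCast, mul_pow]
  push_cast
  ring

lemma levyExponent_levyMeasure (hα₀ : 0 < α) (hα₁ : α < 1) (s : ℝ) :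
    levyExponent (levyMeasure α) s = ∑' n : ℕ, ((α / ((n : ℝ) + 1 - α) : ℝ) : ℂ) *
      ((Complex.I * (s : ℂ)) ^ (n + 1) / (Nat.factorial (n + 1) : ℂ)) := by
  have hsummable : Summable fun n : ℕ =>
      ‖(Complex.I * (s : ℂ)) ^ (n + 1) / (Nat.factorial (n + 1) : ℂ)‖ :=
    (summable_nat_add_iff 1).2 (NormedSpace.expSeries_div_summable (Complex.I * (s : ℂ))).norm
  calc levyExponent (levyMeasure α) s
      = ∫ x in Ioc (0 : ℝ) 1,
          α * ((Complex.exp (Complex.I * s * x) - 1) * ((x ^ (-α - 1) : ℝ) : ℂ)) := by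
        rw [levyExponent_real, integral_levyMeasure hα₀]
        refine setIntegral_congr_fun measurableSet_Ioc fun x _ => ?_
        simp only [Complex.real_smul, Complex.ofReal_mul]
        ring_nf
    _ = α * ∑' n : ℕ, (Complex.I * (s : ℂ)) ^ (n + 1) / (Nat.factorial (n + 1) : ℂ) *
          ((1 / ((n : ℝ) + 1 - α) : ℝ) : ℂ) := by
        rw [integral_const_mul, setIntegral_congr_fun measurableSet_Ioc
          fun x hx => exp_sub_one_mul_rpow_eq_tsum α _ hx.1,
          integral_Ioc_tsum_mul_rpow hα₁ hsummable]
    _ = _ := by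
        rw [← tsum_mul_left]
        refine tsum_congr fun n => ?_
        push_cast
        ring

theorem isLaw_iff_isGeomInfDivLaw (hα₀ : 0 < α) (hα₁ : α < 1) {μ : Measure ℝ} :
    IsLaw α μ ↔ IsGeomInfDivLaw (levyMeasure α) μ := by
  have hphi (s : ℝ) : phi α s = (1 - levyExponent (levyMeasure α) s)⁻¹ := by
    rw [levyExponent_levyMeasure hα₀ hα₁, phi]
  exact ⟨fun h => ⟨h.1, fun s => (h.2 s).trans (hphi s)⟩,
    fun h => ⟨h.1, fun s => (h.2 s).trans (hphi s).symm⟩⟩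

end CharacteristicFunction

section SelfConvolution

variable {f h : ℝ → ℝ}

lemma measurable_of_continuousOn_Ioi (hf₀ : ∀ x ≤ 0, f x = 0) (hf : ContinuousOn f (Ioi 0)) :
    Measurable f := by
  have hind : (Ioi 0).indicator f = f :=
    indicator_eq_self.2 fun x hx => not_le.1 (mt (hf₀ x) hx)
  rw [← hind]
  exact hf.measurable_piecewise continuousOn_const measurableSet_Ioi

lemma conv_apply (f h : ℝ → ℝ) (x : ℝ) : conv f h x = ∫ y, f y * h (x - y) := rfl

lemma conv_self_congr_of_eqOn_Ioo (hf₀ : ∀ x ≤ 0, f x = 0) (hh₀ : ∀ x ≤ 0, h x = 0) {x : ℝ}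
    (hfh : EqOn f h (Ioo 0 x)) : conv f f x = conv h h x := by
  refine integral_congr_ae (ae_of_all _ fun y => ?_)
  change f y * f (x - y) = h y * h (x - y)
  rcases le_or_gt y 0 with hy | hy
  · rw [hf₀ y hy, hh₀ y hy, zero_mul, zero_mul]
  rcases le_or_gt x y with hxy | hxy
  · rw [hf₀ (x - y) (sub_nonpos.2 hxy), hh₀ (x - y) (sub_nonpos.2 hxy), mul_zero, mul_zero]
  · rw [hfh ⟨hy, hxy⟩, hfh ⟨sub_pos.2 hxy, sub_lt_self x hy⟩]

lemma conv_self_of_nonpos (hf₀ : ∀ x ≤ 0, f x = 0) {x : ℝ} (hx : x ≤ 0) : conv f f x = 0 := by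
  rw [conv_self_congr_of_eqOn_Ioo (h := 0) hf₀ (fun _ _ => rfl) (by simp [hx]), conv_apply]
  simp

/-- Integrable functions carried by the positive half-line and continuous there. They may be
singular at `0`, yet their self-convolution is defined everywhere and continuous off `0`. -/
structure IsHalfLineIntegrable (f : ℝ → ℝ) : Prop where
  eq_zero : ∀ x ≤ 0, f x = 0
  continuousOn : ContinuousOn f (Ioi 0)
  integrable : Integrable f

namespace IsHalfLineIntegrable

lemma exists_norm_mul_le (hf : IsHalfLineIntegrable f) {a : ℝ} (ha : 0 < a) (b : ℝ) :
    ∃ M, 0 ≤ M ∧ ∀ x ∈ Icc a b, ∀ y ≤ x / 2, ‖f y * f (x - y)‖ ≤ M * ‖f y‖ := by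
  have hc : ContinuousOn f (Icc (a / 2) b) :=
    hf.continuousOn.mono fun x hx => (half_pos ha).trans_le hx.1
  obtain ⟨M, hM⟩ := isCompact_Icc.exists_bound_of_continuousOn hc
  refine ⟨max M 0, le_max_right _ _, fun x hx y hy => ?_⟩
  rcases le_or_gt y 0 with hy₀ | hy₀
  · simp [hf.eq_zero y hy₀]
  · rw [norm_mul, mul_comm]
    gcongr
    exact (hM _ ⟨by linarith [hx.1], by linarith [hx.2]⟩).trans (le_max_left _ _)

lemma integrable_mul_comp_sub_left (hf : IsHalfLineIntegrable f) (x : ℝ) :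
    Integrable fun y => f y * f (x - y) := by
  have hi' : Integrable fun y => f (x - y) := hf.integrable.comp_sub_left x
  rcases le_or_gt x 0 with hx | hx
  · refine (integrable_zero ℝ ℝ volume).congr (ae_of_all _ fun y => ?_)
    rcases le_total y 0 with hy | hy
    · simp [hf.eq_zero y hy]
    · simp [hf.eq_zero (x - y) (by linarith)]
  obtain ⟨M, hM₀, hM⟩ := hf.exists_norm_mul_le hx x
  have hM (y : ℝ) (hy : y ≤ x / 2) : ‖f y * f (x - y)‖ ≤ M * ‖f y‖ := hM x ⟨le_rfl, le_rfl⟩ y hy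
  refine ((hf.integrable.norm.add hi'.norm).const_mul M).mono'
    (hf.integrable.aestronglyMeasurable.mul hi'.aestronglyMeasurable) (ae_of_all _ fun y => ?_)
  simp only [Pi.add_apply, mul_add]
  rcases le_total y (x / 2) with hy | hy
  · exact (hM y hy).trans (le_add_of_nonneg_right (by positivity))
  · have hsymm := hM (x - y) (by linarith)
    rw [sub_sub_cancel, mul_comm] at hsymm
    exact hsymm.trans (le_add_of_nonneg_left (by positivity))

lemma integrable_conv_self (hf : IsHalfLineIntegrable f) : Integrable (conv f f) :=
  hf.integrable.integrable_convolution _ hf.integrable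

/- Only the half of the integral where the second factor stays away from its singularity at `0`
is kept, so that the integrand is dominated by a multiple of `|f|`. -/
lemma conv_self_eq_two_mul (hf : IsHalfLineIntegrable f) (x : ℝ) :
    conv f f x = 2 * ∫ y, (Iio (x / 2)).indicator (fun y => f y * f (x - y)) y := by
  have hreflect : ∫ y in Ioi (x / 2), f y * f (x - y) = ∫ y in Iio (x / 2), f y * f (x - y) := by
    rw [← integral_indicator measurableSet_Ioi, ← integral_indicator measurableSet_Iio,
      ← integral_sub_left_eq_self _ volume x]
    refine integral_congr_ae (ae_of_all _ fun y => ?_)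
    have hiff : x - y ∈ Ioi (x / 2) ↔ y ∈ Iio (x / 2) := by
      simp only [mem_Ioi, mem_Iio]
      constructor <;> intro <;> linarith
    simp only [indicator_apply, hiff, sub_sub_cancel, mul_comm]
  rw [conv_apply, ← integral_add_compl measurableSet_Iio (hf.integrable_mul_comp_sub_left x),
    compl_Iio, integral_Ici_eq_integral_Ioi, hreflect, two_mul,
    integral_indicator measurableSet_Iio]

lemma continuousAt_indicator_mul_comp_sub_left (hf : IsHalfLineIntegrable f) {x₀ y : ℝ}
    (hx₀ : 0 < x₀) (hy : y ≠ x₀ / 2) :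
    ContinuousAt (fun x => (Iio (x / 2)).indicator (fun y => f y * f (x - y)) y) x₀ := by
  rcases lt_or_gt_of_ne hy with hlt | hgt
  · have hca : ContinuousAt f (x₀ - y) := hf.continuousOn.continuousAt (Ioi_mem_nhds (by linarith))
    have hmul : ContinuousAt (fun x => f y * f (x - y)) x₀ :=
      continuousAt_const.mul (hca.comp (f := fun x => x - y) (by fun_prop))
    refine hmul.congr ?_
    filter_upwards [Ioi_mem_nhds (show 2 * y < x₀ by linarith)] with x (hx : 2 * y < x)
    rw [indicator_of_mem (show y ∈ Iio (x / 2) from (by linarith : y < x / 2))]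
  · refine (continuousAt_const (y := (0 : ℝ))).congr ?_
    filter_upwards [Iio_mem_nhds (show x₀ < 2 * y by linarith)] with x (hx : x < 2 * y)
    rw [indicator_of_notMem (show y ∉ Iio (x / 2) from notMem_Iio.2 (by linarith))]

lemma continuousAt_conv_self (hf : IsHalfLineIntegrable f) {x₀ : ℝ} (hx₀ : x₀ ≠ 0) :
    ContinuousAt (conv f f) x₀ := by
  rcases lt_or_gt_of_ne hx₀ with hneg | hpos
  · refine (continuousAt_const (y := (0 : ℝ))).congr ?_
    filter_upwards [Iio_mem_nhds hneg] with x hx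
    exact (conv_self_of_nonpos hf.eq_zero (le_of_lt hx)).symm
  obtain ⟨M, hM₀, hM⟩ := hf.exists_norm_mul_le (half_pos hpos) (2 * x₀)
  rw [funext hf.conv_self_eq_two_mul]
  refine continuousAt_const.mul (continuousAt_of_dominated (bound := fun y => M * ‖f y‖) ?_ ?_
    (hf.integrable.norm.const_mul M) ?_)
  · exact Eventually.of_forall fun x =>
      (hf.integrable_mul_comp_sub_left x).aestronglyMeasurable.indicator measurableSet_Iio
  · filter_upwards [Icc_mem_nhds (show x₀ / 2 < x₀ by linarith) (show x₀ < 2 * x₀ by linarith)]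
      with x hx
    refine ae_of_all _ fun y => ?_
    by_cases hy : y ∈ Iio (x / 2)
    · rw [indicator_of_mem hy]
      exact hM x hx y (le_of_lt hy)
    · rw [indicator_of_notMem hy, norm_zero]
      positivity
  · filter_upwards [Measure.ae_ne volume (x₀ / 2)] with y hy
    exact hf.continuousAt_indicator_mul_comp_sub_left hpos hy

lemma withDensity_conv_self (hf : IsHalfLineIntegrable f) (hf₀ : ∀ x, 0 ≤ f x) :
    (volume.withDensity fun x => ENNReal.ofReal (f x)) ∗
      (volume.withDensity fun x => ENNReal.ofReal (f x)) =
      volume.withDensity fun x => ENNReal.ofReal (conv f f x) := by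
  have hm := (measurable_of_continuousOn_Ioi hf.eq_zero hf.continuousOn).ennreal_ofReal
  rw [conv_withDensity_eq_lconvolution hm hm]
  congr 1
  funext x
  rw [conv_apply, ofReal_integral_eq_lintegral_ofReal (hf.integrable_mul_comp_sub_left x)
    (ae_of_all _ fun y => mul_nonneg (hf₀ y) (hf₀ (x - y))), lconvolution]
  refine lintegral_congr fun y => ?_
  rw [ENNReal.ofReal_mul (hf₀ y), neg_add_eq_sub]

end IsHalfLineIntegrable

end SelfConvolution

section Primitive

variable {f : ℝ → ℝ}

lemma measureReal_withDensity_ofReal {X : Type*} [MeasurableSpace X] {κ : Measure X} {f : X → ℝ}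
    (hf₀ : ∀ x, 0 ≤ f x) (hf : Integrable f κ) {s : Set X} (hs : MeasurableSet s) :
    (κ.withDensity fun x => ENNReal.ofReal (f x)).real s = ∫ x in s, f x ∂κ := by
  rw [Measure.real, withDensity_apply _ hs, ← ofReal_integral_eq_lintegral_ofReal
    hf.integrableOn (ae_of_all _ hf₀), ENNReal.toReal_ofReal (integral_nonneg hf₀)]

lemma setIntegral_Iic_eq_add_intervalIntegral (hf : Integrable f) (x : ℝ) :
    ∫ y in Iic x, f y = (∫ y in Iic 0, f y) + ∫ y in (0 : ℝ)..x, f y := by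
  rw [← intervalIntegral.integral_Iic_sub_Iic hf.integrableOn hf.integrableOn, add_sub_cancel]

lemma hasDerivAt_setIntegral_Iic (hf : Integrable f) {x : ℝ} (hx : ContinuousAt f x) :
    HasDerivAt (fun x => ∫ y in Iic x, f y) (f x) x := by
  rw [funext (setIntegral_Iic_eq_add_intervalIntegral hf)]
  exact (intervalIntegral.integral_hasDerivAt_right hf.intervalIntegrable
    hf.aestronglyMeasurable.stronglyMeasurableAtFilter hx).const_add _

lemma continuous_measureReal_Iic {κ : Measure ℝ} [IsFiniteMeasure κ] (hκ : κ ≪ volume) :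
    Continuous fun x => κ.real (Iic x) := by
  have hi : Integrable fun x => (κ.rnDeriv volume x).toReal := Measure.integrable_toReal_rnDeriv
  simp_rw [← Measure.setIntegral_toReal_rnDeriv hκ]
  rw [funext (setIntegral_Iic_eq_add_intervalIntegral hi)]
  exact continuous_const.add (hi.continuous_primitive 0)

end Primitive

section LawDensity

variable {α : ℝ} {μ : Measure ℝ}

lemma exists_isLaw (hα₀ : 0 < α) (hα₁ : α < 1) : ∃ μ : Measure ℝ, IsLaw α μ :=
  (exists_isGeomInfDivLaw (integrable_id_levyMeasure hα₀ hα₁)).imp fun _ =>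
    (isLaw_iff_isGeomInfDivLaw hα₀ hα₁).2

lemma IsLaw.unique {μ' : Measure ℝ} (hμ : IsLaw α μ) (hμ' : IsLaw α μ') : μ = μ' := by
  have := hμ.isProbabilityMeasure
  have := hμ'.isProbabilityMeasure
  exact Measure.ext_of_charFun (funext fun s => (hμ.charFun_eq s).trans (hμ'.charFun_eq s).symm)

lemma IsLaw.ae_pos (hα₀ : 0 < α) (hα₁ : α < 1) (hμ : IsLaw α μ) : ∀ᵐ x ∂μ, 0 < x := by
  have hμ := (isLaw_iff_isGeomInfDivLaw hα₀ hα₁).1 hμ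
  have hν := integrable_id_levyMeasure hα₀ hα₁
  have hzero : ∀ᵐ x ∂μ, x ≠ 0 := compl_mem_ae_iff.2
    (hμ.measure_singleton_zero hν (ae_nonneg_levyMeasure α) (levyMeasure_Ioi_zero hα₀))
  filter_upwards [hμ.ae_nonneg hν (ae_nonneg_levyMeasure α), hzero] with x hx hx'
  exact hx.lt_of_ne' hx'

lemma measure_Iic_eq_zero (hμ : ∀ᵐ x ∂μ, 0 < x) {x : ℝ} (hx : x ≤ 0) : μ (Iic x) = 0 :=
  measure_mono_null (fun _ hy => not_lt.2 (le_trans hy hx)) hμ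

lemma dirac_conv_Iic (c : ℝ) (κ : Measure ℝ) [SFinite κ] (x : ℝ) :
    (Measure.dirac c ∗ κ) (Iic x) = κ (Iic (x - c)) := by
  rw [Measure.dirac_conv, Measure.map_apply (by fun_prop) measurableSet_Iic]
  congr 1
  ext y
  simp [le_sub_iff_add_le']

lemma conv_self_Iic_sub_one_le [IsProbabilityMeasure μ] (hμ : ∀ᵐ x ∂μ, 0 < x) (x : ℝ) :
    (μ ∗ μ) (Iic (x - 1)) ≤ μ (Iic x) := by
  have hnonneg : ∀ᵐ x ∂(Measure.dirac (1 : ℝ) ∗ μ), 0 ≤ x :=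
    ae_nonneg_conv (by simp [ae_dirac_eq]) (hμ.mono fun _ => le_of_lt)
  rw [← lintegral_indicator_Ici_add_conv_Iic hnonneg x, Measure.conv_assoc, dirac_conv_Iic]
  exact le_add_self

/-- The density at `x` read off from the size-bias identity for the law `μ`. At `x = 0` it takes
the value `0`, by the convention `y / 0 = 0`. -/
def lawDensity (α : ℝ) (μ : Measure ℝ) (x : ℝ) : ℝ :=
  α * (μ.real (Iic x) - (μ ∗ μ).real (Iic (x - 1))) / x

lemma lawDensity_of_nonpos [IsProbabilityMeasure μ] (hμ : ∀ᵐ x ∂μ, 0 < x) {x : ℝ} (hx : x ≤ 0) :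
    lawDensity α μ x = 0 := by
  have hμx := measure_Iic_eq_zero hμ hx
  have hμμx : (μ ∗ μ) (Iic (x - 1)) = 0 :=
    le_antisymm ((conv_self_Iic_sub_one_le hμ x).trans hμx.le) zero_le
  simp [lawDensity, Measure.real, hμx, hμμx]

lemma lawDensity_nonneg [IsProbabilityMeasure μ] (hα₀ : 0 ≤ α) (hμ : ∀ᵐ x ∂μ, 0 < x) (x : ℝ) :
    0 ≤ lawDensity α μ x := by
  rcases le_or_gt x 0 with hx | hx
  · exact (lawDensity_of_nonpos hμ hx).ge
  · have hle : (μ ∗ μ).real (Iic (x - 1)) ≤ μ.real (Iic x) :=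
      ENNReal.toReal_mono (measure_ne_top _ _) (conv_self_Iic_sub_one_le hμ x)
    exact div_nonneg (mul_nonneg hα₀ (sub_nonneg.2 hle)) hx.le

lemma continuousOn_lawDensity [IsFiniteMeasure μ] (hμ : μ ≪ volume) :
    ContinuousOn (lawDensity α μ) (Ioi 0) := by
  have hconv : μ ∗ μ ≪ volume := Measure.conv_absolutelyContinuous hμ
  have hcdf : Continuous fun x => α * (μ.real (Iic x) - (μ ∗ μ).real (Iic (x - 1))) :=
    continuous_const.mul ((continuous_measureReal_Iic hμ).sub
      ((continuous_measureReal_Iic hconv).comp (continuous_sub_right 1)))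
  exact hcdf.continuousOn.div continuousOn_id fun x hx => ne_of_gt hx

lemma measurable_lawDensity (α : ℝ) (μ : Measure ℝ) : Measurable (lawDensity α μ) :=
  (((measurable_measure_Iic μ).ennreal_toReal.sub ((measurable_measure_Iic (μ ∗ μ)).comp
    (measurable_id.sub_const 1)).ennreal_toReal).const_mul α).div measurable_id

lemma IsLaw.withDensity_id (hα₀ : 0 < α) (hα₁ : α < 1) (hμ : IsLaw α μ) :
    μ.withDensity (fun x => ENNReal.ofReal x) =
      volume.withDensity fun x => ENNReal.ofReal x * ENNReal.ofReal (lawDensity α μ x) := by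
  have := hμ.isProbabilityMeasure
  rw [((isLaw_iff_isGeomInfDivLaw hα₀ hα₁).1 hμ).withDensity_id_eq
    (integrable_id_levyMeasure hα₀ hα₁) (ae_nonneg_levyMeasure α)
    (integrable_dirac (by finiteness)) (by simp [ae_dirac_eq]) (withDensity_id_levyMeasure hα₀)]
  congr 1
  funext x
  rcases le_or_gt x 0 with hx | hx
  · simp [measure_Iic_eq_zero (hμ.ae_pos hα₀ hα₁) hx, ENNReal.ofReal_of_nonpos hx]
  · rw [← ENNReal.ofReal_mul hx.le, lawDensity, mul_div_cancel₀ _ hx.ne', ENNReal.ofReal_mul hα₀.le,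
      ENNReal.ofReal_sub _ measureReal_nonneg, ofReal_measureReal, ofReal_measureReal,
      dirac_conv_Iic]

theorem IsLaw.withDensity_lawDensity (hα₀ : 0 < α) (hα₁ : α < 1) (hμ : IsLaw α μ) :
    volume.withDensity (fun x => ENNReal.ofReal (lawDensity α μ x)) = μ := by
  have := hμ.isProbabilityMeasure
  have hpos := hμ.ae_pos hα₀ hα₁
  have hm : Measurable fun x => ENNReal.ofReal x * ENNReal.ofReal (lawDensity α μ x) :=
    ENNReal.measurable_ofReal.mul (measurable_lawDensity α μ).ennreal_ofReal
  have hinv := withDensity_inv_same ENNReal.measurable_ofReal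
    (hpos.mono fun x hx => ENNReal.ofReal_ne_zero_iff.2 hx)
    (ae_of_all _ fun _ => ENNReal.ofReal_ne_top)
  rw [hμ.withDensity_id hα₀ hα₁, ← withDensity_mul _ hm (by fun_prop)] at hinv
  refine Eq.trans (congrArg volume.withDensity (funext fun x => ?_)) hinv
  rcases le_or_gt x 0 with hx | hx
  · simp [lawDensity_of_nonpos hpos hx]
  · rw [Pi.mul_apply, mul_right_comm, ENNReal.mul_inv_cancel (ENNReal.ofReal_ne_zero_iff.2 hx)
      ENNReal.ofReal_ne_top, one_mul]

theorem IsLaw.isDensity_lawDensity (hα₀ : 0 < α) (hα₁ : α < 1) (hμ : IsLaw α μ) :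
    IsDensity α (lawDensity α μ) := by
  have := hμ.isProbabilityMeasure
  have hpos := hμ.ae_pos hα₀ hα₁
  have hwd := hμ.withDensity_lawDensity hα₀ hα₁
  have hac : μ ≪ volume := hwd ▸ withDensity_absolutelyContinuous _ _
  exact ⟨lawDensity_nonneg hα₀.le hpos, fun x => lawDensity_of_nonpos hpos,
    continuousOn_lawDensity hac, hwd.symm ▸ hμ⟩

end LawDensity

section Density

variable {α : ℝ} {g : ℝ → ℝ}

namespace IsDensity

lemma measurable (hg : IsDensity α g) : Measurable g :=
  measurable_of_continuousOn_Ioi hg.eq_zero hg.continuousOn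

lemma lintegral_eq_one (hg : IsDensity α g) : ∫⁻ x, ENNReal.ofReal (g x) = 1 := by
  have := hg.isLaw.isProbabilityMeasure
  rw [← setLIntegral_univ, ← withDensity_apply _ MeasurableSet.univ, measure_univ]

lemma isHalfLineIntegrable (hg : IsDensity α g) : IsHalfLineIntegrable g := by
  refine ⟨hg.eq_zero, hg.continuousOn, hg.measurable.aestronglyMeasurable, ?_⟩
  rw [hasFiniteIntegral_iff_ofReal (ae_of_all _ hg.nonneg), hg.lintegral_eq_one]
  exact ENNReal.one_lt_top

theorem unique {h : ℝ → ℝ} (hg : IsDensity α g) (hh : IsDensity α h) : g = h := by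
  have hae : (fun x => ENNReal.ofReal (g x)) =ᵐ[volume] fun x => ENNReal.ofReal (h x) :=
    (withDensity_eq_iff hg.measurable.ennreal_ofReal.aemeasurable
      hh.measurable.ennreal_ofReal.aemeasurable
      (hg.lintegral_eq_one.trans_ne ENNReal.one_ne_top)).1 (hg.isLaw.unique hh.isLaw)
  have hae' : g =ᵐ[volume.restrict (Ioi 0)] h := by
    filter_upwards [ae_restrict_of_ae hae] with x hx
    exact (ENNReal.ofReal_eq_ofReal_iff (hg.nonneg x) (hh.nonneg x)).1 hx
  have heq : EqOn g h (Ioi 0) := Measure.eqOn_of_ae_eq hae' hg.continuousOn hh.continuousOn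
    (by rw [interior_Ioi]; exact subset_closure)
  funext x
  rcases le_or_gt x 0 with hx | hx
  · rw [hg.eq_zero x hx, hh.eq_zero x hx]
  · exact heq hx

lemma conv_self_nonneg (hg : IsDensity α g) (x : ℝ) : 0 ≤ conv g g x :=
  integral_nonneg fun y => mul_nonneg (hg.nonneg y) (hg.nonneg (x - y))

theorem eq_integral_div (hα₀ : 0 < α) (hα₁ : α < 1) (hg : IsDensity α g) (x : ℝ) :
    g x = α * ((∫ y in Iic x, g y) - ∫ y in Iic (x - 1), conv g g y) / x := by
  have hi := hg.isHalfLineIntegrable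
  conv_lhs => rw [hg.unique (hg.isLaw.isDensity_lawDensity hα₀ hα₁), lawDensity]
  rw [hi.withDensity_conv_self hg.nonneg,
    measureReal_withDensity_ofReal hg.nonneg hi.integrable measurableSet_Iic,
    measureReal_withDensity_ofReal hg.conv_self_nonneg hi.integrable_conv_self measurableSet_Iic]

lemma hasDerivAt (hα₀ : 0 < α) (hα₁ : α < 1) (hg : IsDensity α g) {x : ℝ} (hx : 0 < x)
    (hx₁ : x ≠ 1) : HasDerivAt g ((-α * conv g g (x - 1) - (1 - α) * g x) / x) x := by
  have hi := hg.isHalfLineIntegrable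
  have hcdf := hasDerivAt_setIntegral_Iic hi.integrable
    (hg.continuousOn.continuousAt (Ioi_mem_nhds hx))
  have hcdf' := (hasDerivAt_setIntegral_Iic hi.integrable_conv_self
    (hi.continuousAt_conv_self (sub_ne_zero.2 hx₁))).comp_sub_const x 1
  have hquot := ((hcdf.sub hcdf').const_mul α).div (hasDerivAt_id x) hx.ne'
  have heq := hg.eq_integral_div hα₀ hα₁
  refine (hquot.congr_of_eventuallyEq (.of_forall heq)).congr_deriv ?_
  have hmul := (eq_div_iff hx.ne').1 (heq x)
  simp only [id_eq, Pi.sub_apply, mul_one]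
  rw [← hmul]
  field_simp
  ring

theorem isContinuousSolution (hα₀ : 0 < α) (hα₁ : α < 1) (hg : IsDensity α g) :
    IsContinuousSolution α g := by
  refine ⟨hg.eq_zero, hg.continuousOn, fun x hx hn => ?_⟩
  have hderiv := hg.hasDerivAt hα₀ hα₁ hx (by simpa using hn 1)
  refine ⟨hderiv.differentiableAt, ?_⟩
  rw [hderiv.deriv]
  field_simp
  ring

end IsDensity

end Density

section ContinuousSolution

variable {α : ℝ} {f h : ℝ → ℝ}

lemma eq_of_hasDerivAt_zero {F : ℝ → ℝ} {a b : ℝ} (hab : a < b) (hF : ContinuousOn F (Icc a b))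
    (hF' : ∀ x ∈ Ioo a b, HasDerivAt F 0 x) : F b = F a := by
  obtain ⟨c, -, hc⟩ := exists_hasDerivAt_eq_slope F 0 hab hF hF'
  exact sub_eq_zero.1 ((div_eq_zero_iff.1 hc.symm).resolve_right (sub_ne_zero.2 hab.ne'))

lemma antitoneOn_Ioi_of_hasDerivAt_nonpos_of_ne {F F' : ℝ → ℝ} {a c : ℝ} (hac : a < c)
    (hF : ContinuousOn F (Ioi a)) (hF' : ∀ x ∈ Ioi a, x ≠ c → HasDerivAt F (F' x) x)
    (hnonpos : ∀ x ∈ Ioi a, F' x ≤ 0) : AntitoneOn F (Ioi a) := by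
  have hpiece {S : Set ℝ} (hS : Convex ℝ S) (hSa : S ⊆ Ioi a) (hSc : c ∉ interior S) :
      AntitoneOn F S := by
    have hderiv (x : ℝ) (hx : x ∈ interior S) : HasDerivAt F (F' x) x :=
      hF' x (hSa (interior_subset hx)) (ne_of_mem_of_not_mem hx hSc)
    exact antitoneOn_of_hasDerivWithinAt_nonpos hS (hF.mono hSa)
      (fun x hx => (hderiv x hx).hasDerivWithinAt)
      fun x hx => hnonpos x (hSa (interior_subset hx))
  have hleft := hpiece (convex_Ioc a c) Ioc_subset_Ioi_self (by simp)
  have hright := hpiece (convex_Ici c) (Ici_subset_Ioi.2 hac) (by simp)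
  rw [← Ioc_union_Ici_eq_Ioi hac]
  exact hleft.union_right hright ⟨⟨hac, le_rfl⟩, fun x hx => hx.2⟩ isLeast_Ici

lemma continuousOn_rpow_mul (p : ℝ) (hf : ContinuousOn f (Ioi 0)) :
    ContinuousOn (fun x => x ^ p * f x) (Ioi 0) :=
  ContinuousOn.mul (fun _ hx => (Real.continuousAt_rpow_const _ _
    (Or.inl (ne_of_gt hx))).continuousWithinAt) hf

/- `x^(1 - α)` is an integrating factor for the left-hand side of the equation. -/
lemma hasDerivAt_rpow_mul {x c f' : ℝ} (hx : 0 < x) (hf : HasDerivAt f f' x)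
    (heq : x * f' + (1 - α) * f x = c) :
    HasDerivAt (fun x => x ^ (1 - α) * f x) (x ^ (-α) * c) x := by
  refine ((Real.hasDerivAt_rpow_const (p := 1 - α) (Or.inl hx.ne')).mul hf).congr_deriv ?_
  rw [← heq, show 1 - α - 1 = -α by ring, show 1 - α = -α + 1 by ring, Real.rpow_add_one hx.ne']
  ring

lemma rpow_one_sub_mul_rpow_sub_one (α : ℝ) {x : ℝ} (hx : 0 < x) :
    x ^ (1 - α) * x ^ (α - 1) = 1 := by
  rw [← Real.rpow_add hx, show 1 - α + (α - 1) = 0 by ring, Real.rpow_zero]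

lemma tendsto_rpow_mul_of_isEquivalent {C : ℝ}
    (hf : f ~[𝓝[>] 0] fun x => C * x ^ (α - 1)) :
    Tendsto (fun x => x ^ (1 - α) * f x) (𝓝[>] 0) (𝓝 C) := by
  have hmul : (fun x => x ^ (1 - α) * f x) ~[𝓝[>] 0] fun x => x ^ (1 - α) * (C * x ^ (α - 1)) :=
    IsEquivalent.refl.mul hf
  have hconst : (fun x => x ^ (1 - α) * (C * x ^ (α - 1))) =ᶠ[𝓝[>] 0] fun _ => C := by
    filter_upwards [self_mem_nhdsWithin] with x hx
    rw [mul_left_comm, rpow_one_sub_mul_rpow_sub_one α hx, mul_one]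
  exact (hmul.congr_right hconst).symm.tendsto_nhds tendsto_const_nhds

lemma ne_natCast_of_mem_Ioo {n : ℕ} {x : ℝ} (hx : x ∈ Ioo (n : ℝ) (n + 1)) (m : ℕ) : x ≠ m := by
  rintro rfl
  have hnm : n < m := by exact_mod_cast hx.1
  have hmn : m < n + 1 := by exact_mod_cast hx.2
  lia

namespace IsContinuousSolution

lemma hasDerivAt_rpow_mul (hf : IsContinuousSolution α f) {x : ℝ} (hx : 0 < x)
    (hn : ∀ n : ℕ, x ≠ n) :
    HasDerivAt (fun x => x ^ (1 - α) * f x) (x ^ (-α) * (-α * conv f f (x - 1))) x :=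
  DarlingMandelbrot.hasDerivAt_rpow_mul hx (hf.equation x hx hn).1.hasDerivAt
    (hf.equation x hx hn).2

lemma eqOn_Ioc_zero_one (hf : IsContinuousSolution α f) :
    EqOn f (fun x => f 1 * x ^ (α - 1)) (Ioc 0 1) := by
  rintro x ⟨hx₀, hx₁⟩
  have hconst : x ^ (1 - α) * f x = f 1 := by
    rcases hx₁.eq_or_lt with rfl | hx₁
    · rw [Real.one_rpow, one_mul]
    have h := eq_of_hasDerivAt_zero hx₁
      ((continuousOn_rpow_mul (1 - α) hf.continuousOn).mono fun y hy => hx₀.trans_le hy.1)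
      fun y hy => by
        have hy₀ : 0 < y := hx₀.trans hy.1
        refine (hf.hasDerivAt_rpow_mul hy₀
          (ne_natCast_of_mem_Ioo (n := 0) (by simpa using ⟨hy₀, hy.2⟩))).congr_deriv ?_
        rw [conv_self_of_nonpos hf.eq_zero (sub_nonpos.2 hy.2.le), mul_zero, mul_zero]
    rwa [Real.one_rpow, one_mul, eq_comm] at h
  change f x = f 1 * x ^ (α - 1)
  rw [← hconst, mul_right_comm, rpow_one_sub_mul_rpow_sub_one α hx₀, one_mul]

lemma apply_one_eq_of_isEquivalent (hf : IsContinuousSolution α f) {C : ℝ}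
    (hf₀ : f ~[𝓝[>] 0] fun x => C * x ^ (α - 1)) : f 1 = C := by
  refine tendsto_nhds_unique (tendsto_const_nhds.congr' ?_) (tendsto_rpow_mul_of_isEquivalent hf₀)
  filter_upwards [Ioc_mem_nhdsGT (zero_lt_one (α := ℝ))] with x hx
  rw [hf.eqOn_Ioc_zero_one hx, mul_left_comm, rpow_one_sub_mul_rpow_sub_one α hx.1, mul_one]

/- On `(n, n + 1)` the convolution term only involves values on `(0, n)`, where the two solutions
agree; hence `x^(1 - α) (f - h)` has zero derivative there. -/
lemma eqOn_Ioc_add_one (hf : IsContinuousSolution α f) (hh : IsContinuousSolution α h) {n : ℕ}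
    (hn : 1 ≤ n) (hfh : EqOn f h (Ioc 0 n)) : EqOn f h (Ioc 0 (n + 1)) := by
  have hn₀ : (0 : ℝ) < n := by exact_mod_cast hn
  rintro x ⟨hx₀, hxn⟩
  rcases le_or_gt x n with hx | hx
  · exact hfh ⟨hx₀, hx⟩
  have hcont := ((continuousOn_rpow_mul (1 - α) hf.continuousOn).sub
    (continuousOn_rpow_mul (1 - α) hh.continuousOn)).mono
      fun y (hy : y ∈ Icc (n : ℝ) x) => hn₀.trans_le hy.1
  have hconst := eq_of_hasDerivAt_zero hx hcont fun y hy => by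
    have hy₀ : 0 < y := hn₀.trans hy.1
    have hyn := ne_natCast_of_mem_Ioo ⟨hy.1, hy.2.trans_le hxn⟩
    have hfhy : EqOn f h (Ioo 0 (y - 1)) :=
      fun z hz => hfh ⟨hz.1, by linarith [hz.2, hy.2]⟩
    refine ((hf.hasDerivAt_rpow_mul hy₀ hyn).sub (hh.hasDerivAt_rpow_mul hy₀ hyn)).congr_deriv ?_
    rw [conv_self_congr_of_eqOn_Ioo hf.eq_zero hh.eq_zero hfhy, sub_self]
  simp only [Pi.sub_apply, hfh (right_mem_Ioc.2 hn₀), sub_self] at hconst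
  exact mul_left_cancel₀ (Real.rpow_pos_of_pos hx₀ _).ne' (sub_eq_zero.1 hconst)

theorem eq_of_apply_one_eq (hf : IsContinuousSolution α f) (hh : IsContinuousSolution α h)
    (hfh : f 1 = h 1) : f = h := by
  have hIoc (n : ℕ) (hn : 1 ≤ n) : EqOn f h (Ioc 0 n) := by
    induction n, hn using Nat.le_induction with
    | base =>
      intro x hx
      rw [Nat.cast_one] at hx
      rw [hf.eqOn_Ioc_zero_one hx, hh.eqOn_Ioc_zero_one hx, hfh]
    | succ n hn ih => simpa only [Nat.cast_add_one] using hf.eqOn_Ioc_add_one hh hn ih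
  funext x
  rcases le_or_gt x 0 with hx | hx
  · rw [hf.eq_zero x hx, hh.eq_zero x hx]
  · obtain ⟨n, hn⟩ := exists_nat_ge x
    exact hIoc n (by exact_mod_cast hx.trans_le hn) ⟨hx, hn⟩

end IsContinuousSolution

end ContinuousSolution

section Origin

variable {α : ℝ} {μ : Measure ℝ} {g : ℝ → ℝ}

lemma integral_rpow_mul_rpow_sub (hα₀ : 0 < α) (hα₁ : α < 1) {x : ℝ} (hx : 0 < x) :
    ∫ y in Ioo 0 x, y ^ (α - 1) * (x - y) ^ (-α) = (C₀ α)⁻¹ := by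
  have hscaled := Complex.betaIntegral_scaled (α : ℂ) ((1 - α : ℝ) : ℂ) hx
  have hreflect := Complex.Gamma_mul_Gamma_eq_betaIntegral (s := (α : ℂ)) (t := ((1 - α : ℝ) : ℂ))
    (by simpa using hα₀) (by simpa using hα₁)
  have hsum : (α : ℂ) + ((1 - α : ℝ) : ℂ) = 1 := by push_cast; ring
  rw [hsum, Complex.Gamma_one, one_mul, Complex.Gamma_ofReal, Complex.Gamma_ofReal,
    ← Complex.ofReal_mul, Real.Gamma_mul_Gamma_one_sub] at hreflect
  rw [hsum, sub_self, Complex.cpow_zero, one_mul, ← hreflect,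
    intervalIntegral.integral_of_le hx.le, integral_Ioc_eq_integral_Ioo] at hscaled
  apply Complex.ofReal_injective
  rw [C₀, inv_div, mul_comm α, ← hscaled, ← integral_complex_ofReal]
  refine setIntegral_congr_fun measurableSet_Ioo fun y hy => ?_
  have hxy := sub_nonneg.2 hy.2.le
  simp only [Complex.ofReal_mul, Complex.ofReal_cpow hy.1.le, Complex.ofReal_cpow hxy]
  congr 2 <;> push_cast <;> ring

lemma measure_Ioi_dirac_one_conv [IsProbabilityMeasure μ] (hμ : ∀ᵐ x ∂μ, 0 < x) {x : ℝ}
    (hx : x < 1) : (Measure.dirac 1 ∗ μ) (Ioi x) = 1 := by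
  rw [← compl_Iic, prob_compl_eq_one_iff measurableSet_Iic, dirac_conv_Iic]
  exact measure_Iic_eq_zero hμ (sub_nonpos.2 hx.le)

theorem IsLaw.ae_lintegral_rpow_eq_one (hα₀ : 0 < α) (hα₁ : α < 1) (hμ : IsLaw α μ) :
    ∀ᵐ x ∂volume.restrict (Ioo 0 1),
      ∫⁻ y, (Ioc 0 1).indicator (fun z => ENNReal.ofReal (z ^ (-α))) (x - y) ∂μ = 1 := by
  have := hμ.isProbabilityMeasure
  have hμ' := (isLaw_iff_isGeomInfDivLaw hα₀ hα₁).1 hμ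
  have hν := integrable_id_levyMeasure hα₀ hα₁
  have hk : Measurable ((Ioc (0 : ℝ) 1).indicator fun z => ENNReal.ofReal (z ^ (-α))) :=
    Measurable.indicator (by fun_prop) measurableSet_Ioc
  have htail := hμ'.integratedTail_add_conv (ρ := Measure.dirac 1) hν (ae_nonneg_levyMeasure α)
    (integrable_dirac (by finiteness)) (by simp [ae_dirac_eq])
  rw [integratedTail_levyMeasure_add_dirac hα₀, ← withDensity_indicator measurableSet_Ioc,
    withDensity_conv hk, integratedTail_eq_withDensity] at htail
  have hae := (withDensity_eq_iff_of_sigmaFinite (Measurable.lintegral_prod_right'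
    (f := fun p : ℝ × ℝ => (Ioc (0 : ℝ) 1).indicator (fun z => ENNReal.ofReal (z ^ (-α)))
      (p.1 - p.2)) (hk.comp (by fun_prop))).aemeasurable
    ((measurable_measure_Ioi _).indicator measurableSet_Ici).aemeasurable).1 htail
  filter_upwards [ae_restrict_of_ae hae, ae_restrict_mem measurableSet_Ioo] with x hx hx₀₁
  rw [hx, indicator_of_mem (show x ∈ Ici 0 from hx₀₁.1.le),
    measure_Ioi_dirac_one_conv (hμ.ae_pos hα₀ hα₁) hx₀₁.2]

lemma lintegral_indicator_rpow_eq {C x : ℝ} (hx : x ∈ Ioo (0 : ℝ) 1)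
    (hg : IsDensity α g) (hC : EqOn g (fun x => C * x ^ (α - 1)) (Ioc 0 1)) :
    ∫⁻ y, (Ioc 0 1).indicator (fun z => ENNReal.ofReal (z ^ (-α))) (x - y)
      ∂(volume.withDensity fun y => ENNReal.ofReal (g y)) =
    ∫⁻ y in Ioo 0 x, ENNReal.ofReal (C * (y ^ (α - 1) * (x - y) ^ (-α))) := by
  have hk : Measurable fun y : ℝ =>
      (Ioc (0 : ℝ) 1).indicator (fun z => ENNReal.ofReal (z ^ (-α))) (x - y) :=
    (Measurable.indicator (by fun_prop) measurableSet_Ioc).comp (by fun_prop)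
  rw [lintegral_withDensity_eq_lintegral_mul _ hg.measurable.ennreal_ofReal hk,
    ← lintegral_indicator measurableSet_Ioo]
  refine lintegral_congr fun y => ?_
  rw [Pi.mul_apply]
  by_cases hy : y ∈ Ioo 0 x
  · rw [indicator_of_mem hy, indicator_of_mem
      (show x - y ∈ Ioc (0 : ℝ) 1 from ⟨by linarith [hy.2], by linarith [hx.2, hy.1]⟩),
      ← ENNReal.ofReal_mul (hg.nonneg _), hC ⟨hy.1, (hy.2.trans hx.2).le⟩, mul_assoc]
  rw [indicator_of_notMem hy]
  rcases le_or_gt y 0 with hy₀ | hy₀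
  · rw [hg.eq_zero y hy₀, ENNReal.ofReal_zero, zero_mul]
  · rw [indicator_of_notMem fun h => hy ⟨hy₀, sub_pos.1 h.1⟩, mul_zero]

namespace IsDensity

theorem apply_one (hα₀ : 0 < α) (hα₁ : α < 1) (hg : IsDensity α g) : g 1 = C₀ α := by
  have : NeBot (ae (volume.restrict (Ioo (0 : ℝ) 1))) := ae_restrict_neBot.2 (by simp)
  obtain ⟨x, hx, hone⟩ := ((ae_restrict_mem measurableSet_Ioo).and
    (hg.isLaw.ae_lintegral_rpow_eq_one hα₀ hα₁)).exists
  rw [lintegral_indicator_rpow_eq hx hg (hg.isContinuousSolution hα₀ hα₁).eqOn_Ioc_zero_one]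
    at hone
  have hint : ∫ y in Ioo 0 x, g 1 * (y ^ (α - 1) * (x - y) ^ (-α)) = 1 := by
    rw [integral_eq_lintegral_of_nonneg_ae, hone, ENNReal.toReal_one]
    · filter_upwards [ae_restrict_mem measurableSet_Ioo] with y hy
      have hy₀ := hy.1
      have hxy := sub_pos.2 hy.2
      have hg₁ := hg.nonneg 1
      positivity
    · exact Measurable.aestronglyMeasurable (by fun_prop)
  rw [integral_const_mul, integral_rpow_mul_rpow_sub hα₀ hα₁ hx.1] at hint
  exact eq_of_mul_inv_eq_one hint

theorem eventuallyEq_rpow (hα₀ : 0 < α) (hα₁ : α < 1) (hg : IsDensity α g) :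
    g =ᶠ[𝓝[>] 0] fun x => C₀ α * x ^ (α - 1) := by
  filter_upwards [Ioc_mem_nhdsGT (zero_lt_one (α := ℝ))] with x hx
  rw [(hg.isContinuousSolution hα₀ hα₁).eqOn_Ioc_zero_one hx, hg.apply_one hα₀ hα₁]

theorem antitoneOn_rpow_mul (hα₀ : 0 < α) (hα₁ : α < 1) (hg : IsDensity α g) :
    AntitoneOn (fun x => x ^ (1 - α) * g x) (Ioi 0) := by
  refine antitoneOn_Ioi_of_hasDerivAt_nonpos_of_ne zero_lt_one
    (continuousOn_rpow_mul (1 - α) hg.continuousOn)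
    (F' := fun x => x ^ (-α) * (-α * conv g g (x - 1))) (fun x hx hx₁ => ?_) fun x hx => ?_
  · have hx : 0 < x := hx
    refine hasDerivAt_rpow_mul hx (hg.hasDerivAt hα₀ hα₁ hx hx₁) ?_
    field_simp
    ring
  · exact mul_nonpos_of_nonneg_of_nonpos (Real.rpow_nonneg (le_of_lt hx) _)
      (mul_nonpos_of_nonpos_of_nonneg (neg_nonpos.2 hα₀.le) (hg.conv_self_nonneg _))

end IsDensity

end Origin

end DarlingMandelbrot

end

theorem theorem3 (α : ℝ) (hα₀ : 0 < α) (hα₁ : α < 1) :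
    -- the Darling–Mandelbrot law has exactly one density that is continuous on `(0, ∞)`
    (∃! g : ℝ → ℝ, DarlingMandelbrot.IsDensity α g) ∧
    ∀ g : ℝ → ℝ, DarlingMandelbrot.IsDensity α g →
      -- it solves the equation, in which the convolution is a convergent integral
      (∀ x : ℝ, ConvolutionExistsAt g g x (ContinuousLinearMap.mul ℝ ℝ) volume) ∧
      DarlingMandelbrot.IsContinuousSolution α g ∧
      -- its behaviour at `0`
      (fun x => g x - DarlingMandelbrot.C₀ α * x ^ (α - 1)) =O[𝓝[>] 0] (fun _ => (1 : ℝ)) ∧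
      g ~[𝓝[>] 0] (fun x => DarlingMandelbrot.C₀ α * x ^ (α - 1)) ∧
      -- uniqueness
      (∀ f : ℝ → ℝ, DarlingMandelbrot.IsContinuousSolution α f →
        f ~[𝓝[>] 0] (fun x => DarlingMandelbrot.C₀ α * x ^ (α - 1)) → f = g) ∧
      AntitoneOn (fun x => x ^ (1 - α) * g x) (Ioi 0) := by
  obtain ⟨μ, hμ⟩ := DarlingMandelbrot.exists_isLaw hα₀ hα₁
  have hd := hμ.isDensity_lawDensity hα₀ hα₁
  refine ⟨⟨_, hd, fun g hg => hg.unique hd⟩, fun g hg => ?_⟩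
  have hsol := hg.isContinuousSolution hα₀ hα₁
  have hzero := hg.eventuallyEq_rpow hα₀ hα₁
  refine ⟨hg.isHalfLineIntegrable.integrable_mul_comp_sub_left, hsol, ?_, hzero.isEquivalent,
    fun f hf hf₀ => hf.eq_of_apply_one_eq hsol ?_, hg.antitoneOn_rpow_mul hα₀ hα₁⟩
  · exact (isBigO_zero _ _).congr' (hzero.mono fun x hx => (sub_eq_zero.2 hx).symm) .rfl
  · rw [hf.apply_one_eq_of_isEquivalent hf₀, hg.apply_one hα₀ hα₁]
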